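/- Let $k\ge 0$. A $k$-graph is a countable small category $\Lambda$ (identified with its set of morphisms, called paths; $r,s$ denote range and source, and objects are identified with identity morphisms) with a functor $d:\Lambda\to\mathbb N^k$ such that whenever $d(\lambda)=m+n$ there are unique $\mu,\nu\in\Lambda$ with $\lambda=\mu\nu$, $d(\mu)=m$, $d(\nu)=n$. The objects are then exactly the elements of $\Lambda^0=d^{-1}(0)$. Put $$\Lambda^{\min}(\lambda,\mu)=\{(\alpha,\beta)\in\Lambda\times\Lambda:\lambda\alpha=\mu\beta,\ d(\lambda\alpha)=d(\lambda)\vee d(\mu)\},$$ and call $\Lambda$ finitely aligned if all these sets are finite. For $v\in\Lambda^0$, a finite set $E\subseteq v\Lambda=r^{-1}(v)$ is finite exhaustive if for every $\mu\in v\Lambda$ there is $\lambda\in E$ with $\Lambda^{\min}(\lambda,\mu)\neq\emptyset$. For $m\in(\mathbb N\cup\{\infty\})^k$ let $\Omega_{k,m}$ be the $k$-graph of pairs $(p,q)$ with $p,q\in\mathbb N^k$, $p\le q\le m$, where $(p,q)(q,u)=(p,u)$ and $d(p,q)=q-p$. Let $X_\Lambda$ be the set of all degree-preserving functors $x:\Omega_{k,m}\to\Lambda$,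 for all such $m$; write $d(x)=m$ and $r(x)=x(0)$. For $n\in\mathbb N^k$, $n\le d(x)$, let $\sigma^nx$ be the path of degree $d(x)-n$ with $(\sigma^nx)(p,q)=x(p+n,q+n)$; for $s(\lambda)=r(x)$ let $\lambda x$ be the path of degree $d(\lambda)+d(x)$ with $(\lambda x)(0,q)=\lambda\, x(0,q-d(\lambda))$ for $d(\lambda)\le q\le d(\lambda)+d(x)$. A path $x$ is a boundary path if for every $n\in\mathbb N^k$ with $n\le d(x)$ and every finite exhaustive $E\subseteq x(n)\Lambda$ there is $\lambda\in E$ with $n+d(\lambda)\le d(x)$ and $x(n,n+d(\lambda))=\lambda$. Let $\partial\Lambda\subseteq X_\Lambda$ be the set of boundary paths. Condition (A) says: for each $v\in\Lambda^0$ there is $x\in\partial\Lambda$ with $r(x)=v$ such that, for all $m,n\in\mathbb N^k$ with $m,n\le d(x)$, $\sigma^mx=\sigma^nx$ implies $m=n$. Suppose that $\Lambda$ is finitely aligned. Let $S_\Lambda$ be the inverse semigroup of all finite sets $F$ of pairs $(\lambda,\mu)\in\Lambda\times\Lambda$ with $s(\lambda)=s(\mu)$ such that $\Lambda^{\min}(\lambda,\xi)=\emptyset=\Lambda^{\min}(\mu,\eta)$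 for distinct $(\lambda,\mu),(\xi,\eta)\in F$, with product $$FG=\{(\lambda\alpha,\eta\beta):(\lambda,\mu)\in F,\ (\xi,\eta)\in G,\ (\alpha,\beta)\in\Lambda^{\min}(\mu,\xi)\}$$ and involution $F^*=\{(\mu,\lambda):(\lambda,\mu)\in F\}$. Let $D_F=\{x\in X_\Lambda: x(0,d(\mu))=\mu\text{ for some }(\lambda,\mu)\in F\}$ and $\theta_F(x)=\lambda\,\sigma^{d(\mu)}x$ for $x\in D_F$, with $(\lambda,\mu)$ the unique such element of $F$. Let $\mathcal G_\Lambda$ be the groupoid of germs $[F,x]$ ($F\in S_\Lambda$, $x\in D_F$), where $[F,x]=[G,y]$ if and only if $x=y$ and $FP=GP$ for some idempotent $P\in S_\Lambda$ with $x\in D_P$, with operations $[F,\theta_G(x)][G,x]=[FG,x]$ and $[F,x]^{-1}=[F^*,\theta_F(x)]$; the unit at $x$ is $[\{(r(x),r(x))\},x]$, and $X_\Lambda$ is identified with the unit space in this way. Give $\mathcal G_\Lambda$ the topology with subbasis $\{\Psi(F),\Psi(F)^c:F\in S_\Lambda\}$, where $\Psi(F)=\{[F,x]:x\in D_F\}$.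 Let $\mathcal G_\Lambda|_{\partial\Lambda}$ be the set of germs with range and source in $\partial\Lambda$, a groupoid with the subspace topology. **Proposition.** Let $\Lambda$ be a finitely aligned $k$-graph. Then $\Lambda$ satisfies condition (A) if and only if $\mathcal G_\Lambda|_{\partial\Lambda}$ is essentially free, that is, the units whose isotropy group is trivial are dense in the unit space of $\mathcal G_\Lambda|_{\partial\Lambda}$. -/

import Mathlib

/-- The inclusion of `ℕ^k` in `(ℕ ∪ {∞})^k`. -/
def toInf {k : ℕ} (n : Fin k → ℕ) : Fin k → ℕ∞ := fun i => (n i : ℕ∞)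

theorem toInf_mono {k : ℕ} {m n : Fin k → ℕ} (h : m ≤ n) : toInf m ≤ toInf n :=
  fun i => Nat.cast_le.mpr (h i)

/-- A `k`-graph with set of morphisms (paths) `Λ`, as an arrows-only category: a countable category
together with a degree functor `d` to `ℕ^k` that has the unique factorization property. The objects
are the morphisms of the form `r a` (equivalently `s a`). The composite `a b` is
`comp a b`; it is meaningful only if `s a = r b`, and is used only then. -/
structure KGraph (k : ℕ) (Λ : Type*) where
  r : Λ → Λ
  s : Λ → Λ
  comp : Λ → Λ → Λ
  d : Λ → Fin k → ℕ
  r_r : ∀ a, r (r a) = r a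
  s_r : ∀ a, s (r a) = r a
  r_s : ∀ a, r (s a) = s a
  s_s : ∀ a, s (s a) = s a
  r_comp : ∀ a b, s a = r b → r (comp a b) = r a
  s_comp : ∀ a b, s a = r b → s (comp a b) = s b
  assoc : ∀ a b c, s a = r b → s b = r c → comp (comp a b) c = comp a (comp b c)
  id_comp : ∀ a, comp (r a) a = a
  comp_id : ∀ a, comp a (s a) = a
  d_comp : ∀ a b, s a = r b → d (comp a b) = d a + d b
  factor : ∀ (a : Λ) (m n : Fin k → ℕ), d a = m + n →
    ∃! p : Λ × Λ, s p.1 = r p.2 ∧ comp p.1 p.2 = a ∧ d p.1 = m ∧ d p.2 = n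
  countable : Countable Λ

namespace KGraph

section Basics

variable {k : ℕ} {Λ : Type*} (Γ : KGraph k Λ)

theorem d_r (a : Λ) : Γ.d (Γ.r a) = 0 := by
  have h := Γ.d_comp (Γ.r a) (Γ.r a) (by rw [Γ.s_r, Γ.r_r])
  have h2 := Γ.id_comp (Γ.r a)
  rw [Γ.r_r] at h2
  rw [h2] at h
  simpa using h

theorem d_s (a : Λ) : Γ.d (Γ.s a) = 0 := by
  rw [← Γ.r_s]; exact Γ.d_r _

theorem factor_inj {a b a' b' : Λ} (h : Γ.s a = Γ.r b) (h' : Γ.s a' = Γ.r b')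
    (e : Γ.comp a b = Γ.comp a' b') (hd : Γ.d a = Γ.d a') : a = a' ∧ b = b' := by
  have e2 : Γ.d b = Γ.d b' := by
    have := congrArg Γ.d e
    rw [Γ.d_comp _ _ h, Γ.d_comp _ _ h', hd] at this
    exact add_left_cancel this
  obtain ⟨p, -, hp⟩ := Γ.factor (Γ.comp a b) (Γ.d a) (Γ.d b) (Γ.d_comp _ _ h)
  have h1 := hp (a, b) ⟨h, rfl, rfl, rfl⟩
  have h2 := hp (a', b') ⟨h', e.symm, hd.symm, e2.symm⟩
  have h3 := h1.trans h2.symm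
  exact ⟨congrArg Prod.fst h3, congrArg Prod.snd h3⟩

theorem left_cancel {a b b' : Λ} (h : Γ.s a = Γ.r b) (h' : Γ.s a = Γ.r b')
    (e : Γ.comp a b = Γ.comp a b') : b = b' := (Γ.factor_inj h h' e rfl).2

theorem eq_s_of_d {a : Λ} (h : Γ.d a = 0) : a = Γ.s a := by
  have := Γ.factor_inj (a := Γ.r a) (b := a) (a' := a) (b' := Γ.s a) (Γ.s_r a) (Γ.r_s a).symm
    (by rw [Γ.id_comp, Γ.comp_id]) (by rw [Γ.d_r, h])
  exact this.2

theorem exists_factor (a : Λ) {m : Fin k → ℕ} (h : m ≤ Γ.d a) :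
    ∃ b c, Γ.s b = Γ.r c ∧ Γ.comp b c = a ∧ Γ.d b = m := by
  obtain ⟨p, hp, -⟩ := Γ.factor a m (Γ.d a - m) (add_tsub_cancel_of_le h).symm
  exact ⟨p.1, p.2, hp.1, hp.2.1, hp.2.2.1⟩

/-- The set `Λ^min(a, b)` of pairs `(α, β)` with `a α = b β` and `d (a α) = d a ∨ d b`. -/
def minExt (a b : Λ) : Set (Λ × Λ) :=
  {p | Γ.s a = Γ.r p.1 ∧ Γ.s b = Γ.r p.2 ∧ Γ.comp a p.1 = Γ.comp b p.2 ∧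
    Γ.d (Γ.comp a p.1) = Γ.d a ⊔ Γ.d b}

/-- A `k`-graph is finitely aligned if all the sets `Λ^min(a, b)` are finite. -/
class FinitelyAligned : Prop where
  finite_minExt : ∀ a b, (Γ.minExt a b).Finite

/-- `E` is a finite exhaustive subset of `vΛ` (where `v` is an object). -/
def IsFiniteExhaustive (v : Λ) (E : Set Λ) : Prop :=
  E.Finite ∧ (∀ a ∈ E, Γ.r a = v) ∧ ∀ b, Γ.r b = v → ∃ a ∈ E, (Γ.minExt a b).Nonempty

theorem exists_min {a b g h : Λ} (hg : Γ.s a = Γ.r g) (hh : Γ.s b = Γ.r h)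
    (e : Γ.comp a g = Γ.comp b h) :
    ∃ p ∈ Γ.minExt a b, ∃ u, Γ.s p.1 = Γ.r u ∧ Γ.s p.2 = Γ.r u ∧
      g = Γ.comp p.1 u ∧ h = Γ.comp p.2 u := by
  have ha : Γ.d a ≤ Γ.d (Γ.comp a g) := by rw [Γ.d_comp _ _ hg]; exact le_self_add
  have hb : Γ.d b ≤ Γ.d (Γ.comp a g) := by rw [e, Γ.d_comp _ _ hh]; exact le_self_add
  obtain ⟨t, u, htu, hcomp, hdt⟩ := Γ.exists_factor (Γ.comp a g) (sup_le ha hb)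
  obtain ⟨a', α, h1, h2, h3⟩ := Γ.exists_factor t (m := Γ.d a) (hdt ▸ le_sup_left)
  obtain ⟨b', β, k1, k2, k3⟩ := Γ.exists_factor t (m := Γ.d b) (hdt ▸ le_sup_right)
  have hαu : Γ.s α = Γ.r u := by rw [← htu, ← h2, Γ.s_comp _ _ h1]
  have hβu : Γ.s β = Γ.r u := by rw [← htu, ← k2, Γ.s_comp _ _ k1]
  have e1 : Γ.comp a' (Γ.comp α u) = Γ.comp a g := by rw [← Γ.assoc _ _ _ h1 hαu, h2, hcomp]
  have e2 : Γ.comp b' (Γ.comp β u) = Γ.comp b h := by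
    rw [← Γ.assoc _ _ _ k1 hβu, k2, hcomp, e]
  obtain ⟨rfl, rfl⟩ := Γ.factor_inj (by rw [Γ.r_comp _ _ hαu, h1]) hg e1 h3
  obtain ⟨rfl, rfl⟩ := Γ.factor_inj (by rw [Γ.r_comp _ _ hβu, k1]) hh e2 k3
  exact ⟨(α, β), ⟨h1, k1, h2.trans k2.symm, by rw [h2, hdt]⟩, u, hαu, hβu, rfl, rfl⟩

end Basics

/-- The morphisms of `Ω_{k,m}`: pairs `(p, q)` in `ℕ^k` with `p ≤ q ≤ m`. -/
@[ext]
structure OmegaArrow (k : ℕ) (m : Fin k → ℕ∞) : Type where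
  p : Fin k → ℕ
  q : Fin k → ℕ
  le : p ≤ q
  le_deg : toInf q ≤ m

namespace OmegaArrow

variable {k : ℕ} {m : Fin k → ℕ∞}

/-- The range `(p, p)` of `(p, q)`. -/
def rg (a : OmegaArrow k m) : OmegaArrow k m :=
  ⟨a.p, a.p, le_rfl, (toInf_mono a.le).trans a.le_deg⟩

/-- The source `(q, q)` of `(p, q)`. -/
def src (a : OmegaArrow k m) : OmegaArrow k m := ⟨a.q, a.q, le_rfl, a.le_deg⟩

/-- The composite `(p, u)` of `(p, q)` and `(q, u)`. -/
def mul (a b : OmegaArrow k m) : OmegaArrow k m :=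
  if h : a.q = b.p then ⟨a.p, b.q, (a.le.trans h.le).trans b.le, b.le_deg⟩ else a

theorem mul_eq {a b : OmegaArrow k m} (h : a.q = b.p) :
    mul a b = ⟨a.p, b.q, (a.le.trans h.le).trans b.le, b.le_deg⟩ := dif_pos h

theorem q_eq_p {a b : OmegaArrow k m} (h : a.src = b.rg) : a.q = b.p :=
  congrArg OmegaArrow.p h

end OmegaArrow

open OmegaArrow in
/-- The `k`-graph `Ω_{k,m}`: the range of `(p, q)` is `p`, its source is `q`, its degree is `q - p`,
and `(p, q) (q, u) = (p, u)`. The object `p` is the morphism `(p, p)`. -/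
def omega (k : ℕ) (m : Fin k → ℕ∞) : KGraph k (OmegaArrow k m) where
  r := rg
  s := src
  comp := mul
  d a := a.q - a.p
  r_r _ := rfl
  s_r _ := rfl
  r_s _ := rfl
  s_s _ := rfl
  r_comp a b h := by rw [mul_eq (q_eq_p h)]; rfl
  s_comp a b h := by rw [mul_eq (q_eq_p h)]; rfl
  assoc a b c h1 h2 := by
    have h1' := q_eq_p h1
    have h2' := q_eq_p h2
    rw [mul_eq h1', mul_eq h2', mul_eq (by exact h2'), mul_eq (by exact h1')]
  id_comp a := mul_eq rfl
  comp_id a := mul_eq rfl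
  d_comp a b h := by
    have h' := q_eq_p h
    rw [mul_eq h']
    funext i
    have h1 : a.p i ≤ a.q i := a.le i
    have h2 : b.p i ≤ b.q i := b.le i
    have h3 : a.q i = b.p i := congrFun h' i
    change b.q i - a.p i = (a.q i - a.p i) + (b.q i - b.p i)
    omega
  factor a m n h := by
    have hq : a.q = a.p + m + n := by
      rw [add_assoc, ← h]; exact (add_tsub_cancel_of_le a.le).symm
    have hle : a.p + m ≤ a.q := by rw [hq]; exact le_self_add
    refine ⟨(⟨a.p, a.p + m, le_self_add, (toInf_mono hle).trans a.le_deg⟩,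
      ⟨a.p + m, a.q, hle, a.le_deg⟩), ⟨rfl, mul_eq rfl, ?_, ?_⟩, ?_⟩
    · simp
    · simp [hq]
    · rintro ⟨b, c⟩ ⟨h1, h2, h3, h4⟩
      have h1' : b.q = c.p := q_eq_p h1
      have h2' : mul b c = a := h2
      rw [mul_eq h1'] at h2'
      have e1 : b.p = a.p := congrArg (fun z => z.p) h2'
      have e2 : c.q = a.q := congrArg (fun z => z.q) h2'
      have e3 : b.q = a.p + m := by
        rw [← h3, ← e1]; exact (add_tsub_cancel_of_le b.le).symm
      exact Prod.ext (OmegaArrow.ext e1 e3) (OmegaArrow.ext (h1'.symm.trans e3) e2)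
  countable := by
    refine Function.Injective.countable
      (f := fun a : OmegaArrow k m => (a.p, a.q)) fun a b h => ?_
    exact OmegaArrow.ext (congrArg Prod.fst h) (congrArg Prod.snd h)

/-- Morphisms of `k`-graphs: degree-preserving functors. -/
structure Hom {k : ℕ} {Λ M : Type*} (Γ : KGraph k Λ) (Δ : KGraph k M) where
  toFun : Λ → M
  map_r : ∀ a, toFun (Γ.r a) = Δ.r (toFun a)
  map_s : ∀ a, toFun (Γ.s a) = Δ.s (toFun a)
  map_comp : ∀ a b, Γ.s a = Γ.r b → toFun (Γ.comp a b) = Δ.comp (toFun a) (toFun b)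
  map_d : ∀ a, Δ.d (toFun a) = Γ.d a

/-- The path space `X_Λ`: all morphisms `Ω_{k,m} → Λ`, where `m ∈ (ℕ ∪ {∞})^k` is the degree. -/
structure PathSpace {k : ℕ} {Λ : Type*} (Γ : KGraph k Λ) where
  deg : Fin k → ℕ∞
  hom : Hom (omega k deg) Γ

namespace PathSpace

variable {k : ℕ} {Λ : Type*} {Γ : KGraph k Λ}

/-- `x(p, q)` for `p ≤ q ≤ d(x)`. -/
def seg (x : PathSpace Γ) (p q : Fin k → ℕ) (hpq : p ≤ q) (hq : toInf q ≤ x.deg) : Λ :=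
  x.hom.toFun ⟨p, q, hpq, hq⟩

/-- The object `x(n)` for `n ≤ d(x)`. -/
def vertex (x : PathSpace Γ) (n : Fin k → ℕ) (hn : toInf n ≤ x.deg) : Λ := x.seg n n le_rfl hn

theorem toInf_zero_le (m : Fin k → ℕ∞) : toInf 0 ≤ m := fun i => by simp [toInf]

/-- The range `r(x) = x(0)`. -/
def range (x : PathSpace Γ) : Λ := x.vertex 0 (toInf_zero_le _)

theorem seg_congr (x : PathSpace Γ) {p q p' q' : Fin k → ℕ} (h1 : p = p') (h2 : q = q') {hpq hq} :
    x.seg p q hpq hq = x.seg p' q' (h1 ▸ h2 ▸ hpq) (h2 ▸ hq) := by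
  subst h1; subst h2; rfl

theorem r_seg (x : PathSpace Γ) (p q : Fin k → ℕ) (hpq hq) :
    Γ.r (x.seg p q hpq hq) = x.vertex p ((toInf_mono hpq).trans hq) :=
  (x.hom.map_r ⟨p, q, hpq, hq⟩).symm

theorem s_seg (x : PathSpace Γ) (p q : Fin k → ℕ) (hpq hq) :
    Γ.s (x.seg p q hpq hq) = x.vertex q hq :=
  (x.hom.map_s ⟨p, q, hpq, hq⟩).symm

theorem d_seg (x : PathSpace Γ) (p q : Fin k → ℕ) (hpq hq) :
    Γ.d (x.seg p q hpq hq) = q - p := x.hom.map_d ⟨p, q, hpq, hq⟩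

theorem seg_comp (x : PathSpace Γ) (p q u : Fin k → ℕ) (hpq : p ≤ q) (hqu : q ≤ u) (hu) :
    Γ.comp (x.seg p q hpq ((toInf_mono hqu).trans hu)) (x.seg q u hqu hu) =
      x.seg p u (hpq.trans hqu) hu := by
  have := x.hom.map_comp ⟨p, q, hpq, (toInf_mono hqu).trans hu⟩ ⟨q, u, hqu, hu⟩ rfl
  exact this.symm.trans (congrArg x.hom.toFun (OmegaArrow.mul_eq rfl))

theorem comp_ok (x : PathSpace Γ) (p q u : Fin k → ℕ) (hpq : p ≤ q) (hqu : q ≤ u) (hu) :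
    Γ.s (x.seg p q hpq ((toInf_mono hqu).trans hu)) = Γ.r (x.seg q u hqu hu) := by
  rw [s_seg, r_seg]

theorem ext_seg {x y : PathSpace Γ} (hdeg : x.deg = y.deg)
    (h : ∀ p q hpq (hx : toInf q ≤ x.deg) (hy : toInf q ≤ y.deg),
      x.seg p q hpq hx = y.seg p q hpq hy) : x = y := by
  obtain ⟨m, ⟨f, _, _, _, _⟩⟩ := x
  obtain ⟨n, ⟨g, _, _, _, _⟩⟩ := y
  dsimp only at hdeg
  subst hdeg
  have : f = g := funext fun a => h a.p a.q a.le a.le_deg a.le_deg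
  subst this
  rfl

theorem ext_init {x y : PathSpace Γ} (n : Fin k → ℕ) (hn : toInf n ≤ x.deg) (hdeg : x.deg = y.deg)
    (h : ∀ q, n ≤ q → ∀ (hx : toInf q ≤ x.deg) (hy : toInf q ≤ y.deg),
      x.seg 0 q zero_le hx = y.seg 0 q zero_le hy) : x = y := by
  refine ext_seg hdeg fun p q hpq hx hy => ?_
  have hqn : toInf (q ⊔ n) ≤ x.deg := fun i => by
    have h1 := hx i
    have h2 := hn i
    simp only [toInf, Pi.sup_apply] at *
    rcases le_total (q i) (n i) with h | h
    · rwa [sup_eq_right.mpr h]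
    · rwa [sup_eq_left.mpr h]
  have hqn' : toInf (q ⊔ n) ≤ y.deg := hdeg ▸ hqn
  have e := h (q ⊔ n) le_sup_right hqn hqn'
  rw [← x.seg_comp 0 q (q ⊔ n) zero_le le_sup_left hqn,
    ← y.seg_comp 0 q (q ⊔ n) zero_le le_sup_left hqn'] at e
  have e2 := (Γ.factor_inj (x.comp_ok _ _ _ _ _ _) (y.comp_ok _ _ _ _ _ _) e
    (by rw [d_seg, d_seg])).1
  rw [← x.seg_comp 0 p q zero_le hpq, ← y.seg_comp 0 p q zero_le hpq] at e2
  exact (Γ.factor_inj (x.comp_ok _ _ _ _ _ _) (y.comp_ok _ _ _ _ _ _) e2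
    (by rw [d_seg, d_seg])).2

theorem add_le_of_le_sub {m : Fin k → ℕ∞} {n q : Fin k → ℕ} (hn : toInf n ≤ m)
    (hq : toInf q ≤ m - toInf n) : toInf (q + n) ≤ m := fun i => by
  have h1 := hn i
  have h2 := hq i
  simp only [toInf, Pi.sub_apply, Pi.add_apply, Nat.cast_add] at *
  exact (add_le_add_left h2 _).trans (tsub_add_cancel_of_le h1).le

/-- The shifted path `σ^m x`, for `m ≤ d(x)`: it has degree `d(x) - m` and
`(σ^m x)(p, q) = x(p + m, q + m)`. -/
def shift (x : PathSpace Γ) (m : Fin k → ℕ) (hm : toInf m ≤ x.deg) : PathSpace Γ where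
  deg := x.deg - toInf m
  hom :=
    { toFun := fun a => x.seg (a.p + m) (a.q + m) (add_le_add_left a.le m)
        (add_le_of_le_sub hm a.le_deg)
      map_r := fun a => by rw [r_seg]; rfl
      map_s := fun a => by rw [s_seg]; rfl
      map_comp := fun a b h => by
        have h' : a.q = b.p := OmegaArrow.q_eq_p h
        have e := x.seg_comp (a.p + m) (a.q + m) (b.q + m) (add_le_add_left a.le m)
          (add_le_add_left (h' ▸ b.le) m) (add_le_of_le_sub hm b.le_deg)
        have e2 : (omega k (x.deg - toInf m)).comp a b = _ := OmegaArrow.mul_eq h'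
        rw [e2, ← e]
        exact congrArg (Γ.comp _) (x.seg_congr (by rw [h']) rfl)
      map_d := fun a => by
        rw [d_seg]
        exact add_tsub_add_eq_tsub_right _ _ _ }

theorem shift_seg (x : PathSpace Γ) (m : Fin k → ℕ) (hm) (p q : Fin k → ℕ) (hpq hq) :
    (x.shift m hm).seg p q hpq hq =
      x.seg (p + m) (q + m) (add_le_add_left hpq m) (add_le_of_le_sub hm hq) := rfl

theorem range_shift (x : PathSpace Γ) (m : Fin k → ℕ) (hm) :
    (x.shift m hm).range = x.vertex m hm :=
  x.seg_congr (hpq := le_rfl) (hq := by rw [zero_add]; exact hm) (zero_add m) (zero_add m)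

/-- The path determined by its initial segments `f q`, for `q ≤ m`. -/
noncomputable def ofInit (m : Fin k → ℕ∞) (f : (q : Fin k → ℕ) → toInf q ≤ m → Λ)
    (hd : ∀ q h, Γ.d (f q h) = q)
    (hc : ∀ p q (hpq : p ≤ q) (h : toInf q ≤ m),
      ∃ b, Γ.s (f p ((toInf_mono hpq).trans h)) = Γ.r b ∧
        Γ.comp (f p ((toInf_mono hpq).trans h)) b = f q h) : PathSpace Γ where
  deg := m
  hom :=
    { toFun := fun a => Classical.choose (hc a.p a.q a.le a.le_deg)
      map_r := fun a => by
        have h1 := Classical.choose_spec (hc a.p a.q a.le a.le_deg)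
        have h2 := Classical.choose_spec (hc a.p a.p le_rfl ((toInf_mono a.le).trans a.le_deg))
        rw [← h1.1]
        exact Γ.left_cancel h2.1 (Γ.r_s _).symm (by rw [Γ.comp_id]; exact h2.2)
      map_s := fun a => by
        have h1 := Classical.choose_spec (hc a.p a.q a.le a.le_deg)
        have h2 := Classical.choose_spec (hc a.q a.q le_rfl a.le_deg)
        have h3 : Γ.s (Classical.choose (hc a.p a.q a.le a.le_deg)) = Γ.s (f a.q a.le_deg) := by
          rw [← Γ.s_comp _ _ h1.1, h1.2]
        rw [h3]
        exact Γ.left_cancel h2.1 (Γ.r_s _).symm (by rw [Γ.comp_id]; exact h2.2)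
      map_comp := fun a b h => by
        obtain ⟨p, q, hpq, hq⟩ := a
        obtain ⟨q', u, hqu, hu⟩ := b
        have h' : q = q' := OmegaArrow.q_eq_p h
        subst h'
        have h1 := Classical.choose_spec (hc p q hpq hq)
        have h2 := Classical.choose_spec (hc q u hqu hu)
        have h3 := Classical.choose_spec (hc p u (hpq.trans hqu) hu)
        have h12 : Γ.s (Classical.choose (hc p q hpq hq)) =
            Γ.r (Classical.choose (hc q u hqu hu)) := by
          rw [← h2.1, ← Γ.s_comp _ _ h1.1]; exact congrArg Γ.s h1.2
        have e2 : (omega k m).comp ⟨p, q, hpq, hq⟩ ⟨q, u, hqu, hu⟩ = _ := OmegaArrow.mul_eq rfl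
        rw [e2]
        refine Γ.left_cancel h3.1 (by rw [Γ.r_comp _ _ h12]; exact h1.1) ?_
        rw [h3.2, ← Γ.assoc _ _ _ h1.1 h12, h1.2, h2.2]
      map_d := fun a => by
        have h1 := Classical.choose_spec (hc a.p a.q a.le a.le_deg)
        have h2 := congrArg Γ.d h1.2
        rw [Γ.d_comp _ _ h1.1, hd, hd] at h2
        exact (tsub_eq_of_eq_add_rev h2.symm).symm }

theorem ofInit_seg (m : Fin k → ℕ∞) (f : (q : Fin k → ℕ) → toInf q ≤ m → Λ)
    (hd : ∀ q h, Γ.d (f q h) = q) (hc) (q : Fin k → ℕ) (hq) :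
    (ofInit (Γ := Γ) m f hd hc).seg 0 q zero_le hq = f q hq := by
  have h1 := Classical.choose_spec (hc 0 q zero_le hq)
  have h2 : f 0 (toInf_zero_le _) = Γ.s (f 0 (toInf_zero_le _)) := Γ.eq_s_of_d (hd _ _)
  have h3 := Γ.id_comp (Classical.choose (hc 0 q zero_le hq))
  exact (((congrArg (fun z => Γ.comp z _) (h2.trans h1.1)).trans h3).symm).trans h1.2

theorem sub_le_deg {m : Fin k → ℕ∞} {n q : Fin k → ℕ} (hq : toInf q ≤ toInf n + m) :
    toInf (q - n) ≤ m := fun i => by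
  have h := hq i
  simp only [toInf, Pi.sub_apply, Pi.add_apply] at *
  rw [ENat.natCast_sub]
  exact tsub_le_iff_left.mpr h

theorem comp_seg_ok (a : Λ) (x : PathSpace Γ) (h : Γ.s a = x.range) (q : Fin k → ℕ) (hq) :
    Γ.s a = Γ.r (x.seg 0 q zero_le hq) := by
  rw [r_seg, h]; rfl

theorem exists_init (a : Λ) (x : PathSpace Γ) (h : Γ.s a = x.range) (q : Fin k → ℕ)
    (hq : toInf q ≤ toInf (Γ.d a) + x.deg) :
    ∃ b c, Γ.s b = Γ.r c ∧ Γ.comp b c =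
      Γ.comp a (x.seg 0 (q - Γ.d a) zero_le (sub_le_deg hq)) ∧ Γ.d b = q :=
  Γ.exists_factor _ (by
    rw [Γ.d_comp _ _ (comp_seg_ok a x h _ _), d_seg, tsub_zero]; exact le_add_tsub)

/-- For `s(a) = r(x)` and `q ≤ d(a) + d(x)`, the initial segment of degree `q` of the path
`a x(0, (q - d(a)) ∨ 0)`. -/
noncomputable def initSeg (a : Λ) (x : PathSpace Γ) (h : Γ.s a = x.range) (q : Fin k → ℕ)
    (hq : toInf q ≤ toInf (Γ.d a) + x.deg) : Λ :=
  Classical.choose (exists_init a x h q hq)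

theorem initSeg_spec (a : Λ) (x : PathSpace Γ) (h : Γ.s a = x.range) (q : Fin k → ℕ)
    (hq : toInf q ≤ toInf (Γ.d a) + x.deg) :
    ∃ c, Γ.s (initSeg a x h q hq) = Γ.r c ∧ Γ.comp (initSeg a x h q hq) c =
      Γ.comp a (x.seg 0 (q - Γ.d a) zero_le (sub_le_deg hq)) ∧ Γ.d (initSeg a x h q hq) = q :=
  Classical.choose_spec (exists_init a x h q hq)

theorem d_initSeg (a : Λ) (x : PathSpace Γ) (h) (q : Fin k → ℕ) (hq) :
    Γ.d (initSeg a x h q hq) = q := (initSeg_spec a x h q hq).choose_spec.2.2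

theorem initSeg_mono (a : Λ) (x : PathSpace Γ) (h : Γ.s a = x.range) (p q : Fin k → ℕ)
    (hpq : p ≤ q) (hq : toInf q ≤ toInf (Γ.d a) + x.deg) :
    ∃ b, Γ.s (initSeg a x h p ((toInf_mono hpq).trans hq)) = Γ.r b ∧
      Γ.comp (initSeg a x h p ((toInf_mono hpq).trans hq)) b = initSeg a x h q hq := by
  have hp := (toInf_mono hpq).trans hq
  obtain ⟨c, h1, h2, h3⟩ := initSeg_spec a x h p hp
  obtain ⟨c', k1, k2, k3⟩ := initSeg_spec a x h q hq
  obtain ⟨u, v, l1, l2, l3⟩ := Γ.exists_factor (initSeg a x h q hq) (m := p) (by rw [k3]; exact hpq)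
  have hle : p - Γ.d a ≤ q - Γ.d a := tsub_le_tsub_right hpq _
  have e := x.seg_comp 0 (p - Γ.d a) (q - Γ.d a) zero_le hle (sub_le_deg hq)
  have ok := x.comp_ok 0 (p - Γ.d a) (q - Γ.d a) zero_le hle (sub_le_deg hq)
  have ok2 := comp_seg_ok a x h (p - Γ.d a) (sub_le_deg hp)
  have hvc : Γ.s v = Γ.r c' := by rw [← k1, ← l2, Γ.s_comp _ _ l1]
  have hcw : Γ.s c = Γ.r (x.seg (p - Γ.d a) (q - Γ.d a) hle (sub_le_deg hq)) := by
    rw [← ok, ← Γ.s_comp _ _ ok2, ← h2, Γ.s_comp _ _ h1]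
  have key : Γ.comp u (Γ.comp v c') = Γ.comp (initSeg a x h p hp)
      (Γ.comp c (x.seg (p - Γ.d a) (q - Γ.d a) hle (sub_le_deg hq))) := by
    rw [← Γ.assoc _ _ _ l1 hvc, l2, k2, ← e, ← Γ.assoc _ _ _ ok2 ok, ← h2,
      Γ.assoc _ _ _ h1 hcw]
  have := (Γ.factor_inj (by rw [Γ.r_comp _ _ hvc]; exact l1)
    (by rw [Γ.r_comp _ _ hcw]; exact h1) key (by rw [l3, h3])).1
  exact ⟨v, this ▸ l1, this ▸ l2⟩

/-- The path `a x`, for `s(a) = r(x)`: it has degree `d(a) + d(x)`, and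
`(a x)(0, q) = a x(0, q - d(a))` if `d(a) ≤ q`. -/
noncomputable def prepend (a : Λ) (x : PathSpace Γ) (h : Γ.s a = x.range) : PathSpace Γ :=
  ofInit (toInf (Γ.d a) + x.deg) (initSeg a x h) (d_initSeg a x h) (initSeg_mono a x h)

theorem prepend_deg (a : Λ) (x : PathSpace Γ) (h) :
    (prepend a x h).deg = toInf (Γ.d a) + x.deg := rfl

theorem prepend_seg (a : Λ) (x : PathSpace Γ) (h) (q : Fin k → ℕ) (hdq : Γ.d a ≤ q)
    (hq : toInf q ≤ (prepend a x h).deg) :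
    (prepend a x h).seg 0 q zero_le hq =
      Γ.comp a (x.seg 0 (q - Γ.d a) zero_le (sub_le_deg hq)) := by
  refine Eq.trans (ofInit_seg _ _ _ _ q hq) ?_
  obtain ⟨c, h1, h2, h3⟩ := initSeg_spec a x h q hq
  have hc : Γ.d c = 0 := by
    have := congrArg Γ.d h2
    rw [Γ.d_comp _ _ h1, h3, Γ.d_comp _ _ (comp_seg_ok a x h _ _), d_seg, tsub_zero,
      add_tsub_cancel_of_le hdq] at this
    simpa using this
  have hc2 : c = Γ.s (initSeg a x h q hq) := by
    have h4 : Γ.r c = c := by rw [Γ.eq_s_of_d hc, Γ.r_s]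
    rw [h1, h4]
  rw [hc2, Γ.comp_id] at h2
  exact h2


theorem range_prepend (a : Λ) (x : PathSpace Γ) (h) : (prepend a x h).range = Γ.r a := by
  have hle : toInf (Γ.d a) ≤ (prepend a x h).deg := le_self_add
  have e := prepend_seg a x h (Γ.d a) le_rfl hle
  have e2 := congrArg Γ.r e
  rw [r_seg, Γ.r_comp _ _ (comp_seg_ok a x h _ _)] at e2
  exact e2

/-- `x` has initial segment `a`: `x(0, d(a)) = a` (in particular `d(a) ≤ d(x)`). -/
def Begins (x : PathSpace Γ) (a : Λ) : Prop :=
  ∃ h : toInf (Γ.d a) ≤ x.deg, x.seg 0 (Γ.d a) zero_le h = a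

theorem Begins.range_shift {x : PathSpace Γ} {a : Λ} (h : x.Begins a) :
    Γ.s a = (x.shift (Γ.d a) h.1).range := by
  rw [PathSpace.range_shift, ← x.s_seg 0 (Γ.d a) zero_le h.1, h.2]

theorem begins_prepend (a : Λ) (x : PathSpace Γ) (h) : (prepend a x h).Begins a := by
  refine ⟨le_self_add, ?_⟩
  rw [prepend_seg a x h _ le_rfl le_self_add]
  have e : x.seg 0 (Γ.d a - Γ.d a) zero_le (sub_le_deg le_self_add) = x.range :=
    x.seg_congr rfl (tsub_self _)
  rw [e, ← h, Γ.comp_id]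

theorem prepend_shift {x : PathSpace Γ} {a : Λ} (h : x.Begins a) :
    prepend a (x.shift (Γ.d a) h.1) h.range_shift = x := by
  have hdeg : (prepend a (x.shift (Γ.d a) h.1) h.range_shift).deg = x.deg :=
    add_tsub_cancel_of_le h.1
  refine ext_init (Γ.d a) (hdeg ▸ h.1) hdeg fun q hq hx hy => ?_
  have e := x.seg_comp 0 (Γ.d a) q zero_le hq hy
  rw [h.2] at e
  rw [prepend_seg _ _ _ q hq hx, shift_seg, ← e]
  exact congrArg (Γ.comp a) (x.seg_congr (zero_add _) (tsub_add_cancel_of_le hq))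

theorem shift_prepend (a : Λ) (x : PathSpace Γ) (h) (hm) :
    (prepend a x h).shift (Γ.d a) hm = x := by
  have hdeg : ((prepend a x h).shift (Γ.d a) hm).deg = x.deg := by
    funext i
    exact (ENat.addLECancellable_natCast (Γ.d a i)).add_tsub_cancel_left
  refine ext_init 0 (toInf_zero_le _) hdeg fun q _ hx hy => ?_
  have hq : toInf (q + Γ.d a) ≤ (prepend a x h).deg := add_le_of_le_sub hm hx
  have hdq : Γ.d a ≤ q + Γ.d a := le_add_self
  have e := (prepend a x h).seg_comp 0 (Γ.d a) (q + Γ.d a) zero_le hdq hq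
  have e2 := (begins_prepend a x h).2
  have ok := (prepend a x h).comp_ok 0 (Γ.d a) (q + Γ.d a) zero_le hdq hq
  rw [prepend_seg a x h _ hdq hq, e2] at e
  rw [e2] at ok
  have e3 := Γ.left_cancel ok (comp_seg_ok a x h _ _) e
  rw [shift_seg]
  exact ((prepend a x h).seg_congr (zero_add _) rfl).trans
    (e3.trans (x.seg_congr rfl (add_tsub_cancel_right _ _)))

theorem prepend_inj {a : Λ} {x y : PathSpace Γ} {hx hy}
    (e : prepend a x hx = prepend a y hy) : x = y := by
  have h1 := shift_prepend a x hx le_self_add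
  have h2 := shift_prepend a y hy le_self_add
  rw [← h1, ← h2]
  congr 1

theorem prepend_comp (a b : Λ) (x : PathSpace Γ) (hab : Γ.s a = Γ.r b) (h : Γ.s b = x.range) (h1) :
    prepend (Γ.comp a b) x h1 =
      prepend a (prepend b x h) (hab.trans (range_prepend b x h).symm) := by
  have hdeg : toInf (Γ.d (Γ.comp a b)) = toInf (Γ.d a) + toInf (Γ.d b) := by
    rw [Γ.d_comp _ _ hab]; funext i; simp [toInf]
  refine ext_init (Γ.d (Γ.comp a b)) le_self_add ?_ fun q hq hx hy => ?_
  · rw [prepend_deg, prepend_deg, prepend_deg, hdeg, add_assoc]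
  · have hq' : Γ.d a + Γ.d b ≤ q := by rw [← Γ.d_comp _ _ hab]; exact hq
    rw [prepend_seg _ _ _ q hq hx, prepend_seg _ _ _ q (le_self_add.trans hq') hy,
      prepend_seg b x h _ (le_tsub_of_add_le_left hq') (sub_le_deg hy),
      Γ.assoc _ _ _ hab (comp_seg_ok b x h _ _)]
    exact congrArg (fun z => Γ.comp a (Γ.comp b z))
      (x.seg_congr rfl (by rw [Γ.d_comp _ _ hab, tsub_tsub]))

theorem exists_split (x : PathSpace Γ) (n : Fin k → ℕ) (hn : toInf n ≤ x.deg) :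
    ∃ u : PathSpace Γ, ∃ t h, t = x.seg 0 n zero_le hn ∧ prepend t u h = x := by
  have et : Γ.d (x.seg 0 n zero_le hn) = n := by rw [d_seg, tsub_zero]
  have bt : x.Begins (x.seg 0 n zero_le hn) :=
    ⟨by rw [et]; exact hn, x.seg_congr rfl et⟩
  exact ⟨_, _, bt.range_shift, rfl, prepend_shift bt⟩

theorem exists_min_path {a b : Λ} {z w : PathSpace Γ} (ha : Γ.s a = z.range) (hb : Γ.s b = w.range)
    (e : prepend a z ha = prepend b w hb) :
    ∃ p ∈ Γ.minExt a b, ∃ (u : PathSpace Γ) (h1 : Γ.s p.1 = u.range) (h2 : Γ.s p.2 = u.range),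
      z = prepend p.1 u h1 ∧ w = prepend p.2 u h2 := by
  have ba := begins_prepend a z ha
  have bb := begins_prepend b w hb
  rw [← e] at bb
  have hn : toInf (Γ.d a ⊔ Γ.d b) ≤ (prepend a z ha).deg := fun i => by
    have h1 := ba.1 i
    have h2 := bb.1 i
    simp only [toInf, Pi.sup_apply] at *
    rcases le_total (Γ.d a i) (Γ.d b i) with h | h
    · rwa [sup_eq_right.mpr h]
    · rwa [sup_eq_left.mpr h]
  have e1 := (prepend a z ha).seg_comp 0 (Γ.d a) _ zero_le (le_sup_left (b := Γ.d b)) hn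
  have o1 := (prepend a z ha).comp_ok 0 (Γ.d a) _ zero_le (le_sup_left (b := Γ.d b)) hn
  have e2 := (prepend a z ha).seg_comp 0 (Γ.d b) _ zero_le (le_sup_right (a := Γ.d a)) hn
  have o2 := (prepend a z ha).comp_ok 0 (Γ.d b) _ zero_le (le_sup_right (a := Γ.d a)) hn
  have s1 := (prepend a z ha).s_seg (Γ.d a) _ (le_sup_left (b := Γ.d b)) hn
  have s2 := (prepend a z ha).s_seg (Γ.d b) _ (le_sup_right (a := Γ.d a)) hn
  have et : Γ.d ((prepend a z ha).seg 0 _ zero_le hn) = Γ.d a ⊔ Γ.d b := by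
    rw [d_seg, tsub_zero]
  rw [ba.2] at e1 o1
  rw [bb.2] at e2 o2
  generalize (prepend a z ha).seg (Γ.d a) (Γ.d a ⊔ Γ.d b) le_sup_left hn = α at *
  generalize (prepend a z ha).seg (Γ.d b) (Γ.d a ⊔ Γ.d b) le_sup_right hn = β at *
  obtain ⟨u, t, rt, ht, pt⟩ := exists_split _ _ hn
  rw [← ht] at e1 e2 et
  have h1 : Γ.s α = u.range := by rw [← rt, ← e1, Γ.s_comp _ _ o1]
  have h2 : Γ.s β = u.range := by rw [← rt, ← e2, Γ.s_comp _ _ o2]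
  refine ⟨(α, β), ⟨o1, o2, e1.trans e2.symm, by rw [e1, et]⟩, u, h1, h2, ?_, ?_⟩
  · subst e1
    rw [prepend_comp a α u o1 h1] at pt
    exact (prepend_inj pt).symm
  · subst e2
    rw [prepend_comp b β u o2 h2] at pt
    exact (prepend_inj (pt.trans e)).symm

/-- `x` is a boundary path: for all `n ≤ d(x)` and every finite exhaustive set `E ⊆ x(n)Λ` there is
`a ∈ E` with `x(n, n + d(a)) = a`. -/
def IsBoundary (x : PathSpace Γ) : Prop :=
  ∀ (n : Fin k → ℕ) (hn : toInf n ≤ x.deg) (E : Set Λ), Γ.IsFiniteExhaustive (x.vertex n hn) E →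
    ∃ a ∈ E, ∃ h : toInf (n + Γ.d a) ≤ x.deg, x.seg n (n + Γ.d a) le_self_add h = a

end PathSpace

/-- Condition (A): every object `v` is the range of a boundary path `x` such that
`σ^m x = σ^n x` implies `m = n` for all `m, n ≤ d(x)`. -/
def ConditionA {k : ℕ} {Λ : Type*} (Γ : KGraph k Λ) : Prop :=
  ∀ v, Γ.d v = 0 → ∃ x : PathSpace Γ, x.IsBoundary ∧ x.range = v ∧
    ∀ (m n : Fin k → ℕ) (hm : toInf m ≤ x.deg) (hn : toInf n ≤ x.deg),
      x.shift m hm = x.shift n hn → m = n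

/-- The elements of the inverse semigroup `S_Λ`: finite sets `F` of pairs `(a, b)` with
`s(a) = s(b)` such that distinct `(a, b), (a', b') ∈ F` satisfy `Λ^min(a, a') = ∅` and
`Λ^min(b, b') = ∅`. -/
@[ext]
structure InvSemi {k : ℕ} {Λ : Type*} (Γ : KGraph k Λ) where
  carrier : Set (Λ × Λ)
  finite : carrier.Finite
  s_eq : ∀ p ∈ carrier, Γ.s p.1 = Γ.s p.2
  perp : ∀ p ∈ carrier, ∀ q ∈ carrier, p ≠ q →
    Γ.minExt p.1 q.1 = ∅ ∧ Γ.minExt p.2 q.2 = ∅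

namespace InvSemi

variable {k : ℕ} {Λ : Type*} {Γ : KGraph k Λ}

theorem eq_of_fst (F : InvSemi Γ) {p q : Λ × Λ} (hp : p ∈ F.carrier) (hq : q ∈ F.carrier) {g h : Λ}
    (hg : Γ.s p.1 = Γ.r g) (hh : Γ.s q.1 = Γ.r h) (e : Γ.comp p.1 g = Γ.comp q.1 h) : p = q := by
  by_contra hne
  obtain ⟨m, hm, -⟩ := Γ.exists_min hg hh e
  rw [(F.perp p hp q hq hne).1] at hm
  exact hm

theorem eq_of_snd (F : InvSemi Γ) {p q : Λ × Λ} (hp : p ∈ F.carrier) (hq : q ∈ F.carrier) {g h : Λ}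
    (hg : Γ.s p.2 = Γ.r g) (hh : Γ.s q.2 = Γ.r h) (e : Γ.comp p.2 g = Γ.comp q.2 h) : p = q := by
  by_contra hne
  obtain ⟨m, hm, -⟩ := Γ.exists_min hg hh e
  rw [(F.perp p hp q hq hne).2] at hm
  exact hm

/-- The singleton `{(a, b)}`, where `s(a) = s(b)`. -/
def single (a b : Λ) (h : Γ.s a = Γ.s b) : InvSemi Γ where
  carrier := {(a, b)}
  finite := Set.finite_singleton _
  s_eq := by rintro _ rfl; exact h
  perp := by rintro _ rfl _ rfl hne; exact absurd rfl hne

/-- The involution `F* = {(b, a) : (a, b) ∈ F}`. -/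
def star (F : InvSemi Γ) : InvSemi Γ where
  carrier := {p | p.swap ∈ F.carrier}
  finite := F.finite.preimage Prod.swap_injective.injOn
  s_eq p hp := (F.s_eq _ hp).symm
  perp p hp q hq hne :=
    ⟨(F.perp _ hp _ hq fun h => hne (Prod.swap_injective h)).2,
      (F.perp _ hp _ hq fun h => hne (Prod.swap_injective h)).1⟩

/-- The product `FG`: all `(a α, b' β)` with `(a, b) ∈ F`, `(a', b') ∈ G`, `(α, β) ∈ Λ^min(b, a')`. -/
instance [Γ.FinitelyAligned] : Mul (InvSemi Γ) where
  mul F G :=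
    { carrier := {t | ∃ p ∈ F.carrier, ∃ q ∈ G.carrier, ∃ m ∈ Γ.minExt p.2 q.1,
        t = (Γ.comp p.1 m.1, Γ.comp q.2 m.2)}
      finite := by
        have h : (⋃ p ∈ F.carrier, ⋃ q ∈ G.carrier,
            (fun m : Λ × Λ => (Γ.comp p.1 m.1, Γ.comp q.2 m.2)) '' Γ.minExt p.2 q.1).Finite :=
          F.finite.biUnion fun _ _ => G.finite.biUnion fun _ _ =>
            (FinitelyAligned.finite_minExt _ _).image _
        refine h.subset ?_
        rintro t ⟨p, hp, q, hq, m, hm, rfl⟩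
        simp only [Set.mem_iUnion]
        exact ⟨p, hp, q, hq, m, hm, rfl⟩
      s_eq := by
        rintro t ⟨p, hp, q, hq, m, hm, rfl⟩
        have h1 := F.s_eq p hp
        have h2 := G.s_eq q hq
        have h3 := congrArg Γ.s hm.2.2.1
        rw [Γ.s_comp _ _ hm.1, Γ.s_comp _ _ hm.2.1] at h3
        dsimp only
        rw [Γ.s_comp _ _ (h1.trans hm.1), Γ.s_comp _ _ (h2.symm.trans hm.2.1), h3]
      perp := by
        rintro t ⟨p, hp, q, hq, m, hm, rfl⟩ t' ⟨p', hp', q', hq', m', hm', rfl⟩ hne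
        have a1 := (F.s_eq p hp).trans hm.1
        have a2 := (G.s_eq q hq).symm.trans hm.2.1
        have a1' := (F.s_eq p' hp').trans hm'.1
        have a2' := (G.s_eq q' hq').symm.trans hm'.2.1
        have s1 := Γ.s_comp _ _ a1
        have s2 := Γ.s_comp _ _ a2
        have s1' := Γ.s_comp _ _ a1'
        have s2' := Γ.s_comp _ _ a2'
        have deq : ∀ {p q p' q' : Λ × Λ}, p = p' → q = q' → m ∈ Γ.minExt p.2 q.1 →
            m' ∈ Γ.minExt p'.2 q'.1 → Γ.d m.1 = Γ.d m'.1 ∧ Γ.d m.2 = Γ.d m'.2 := by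
          rintro p q _ _ rfl rfl h h'
          have e := h.2.2.2.trans h'.2.2.2.symm
          have e' := e
          rw [h.2.2.1, h'.2.2.1, Γ.d_comp _ _ h.2.1, Γ.d_comp _ _ h'.2.1] at e'
          rw [Γ.d_comp _ _ h.1, Γ.d_comp _ _ h'.1] at e
          exact ⟨add_left_cancel e, add_left_cancel e'⟩
        constructor
        · rw [Set.eq_empty_iff_forall_notMem]
          rintro ⟨c, c'⟩ ⟨h1, h2, h3, -⟩
          dsimp only at h1 h2 h3
          rw [s1] at h1
          rw [s1'] at h2
          rw [Γ.assoc _ _ _ a1 h1, Γ.assoc _ _ _ a1' h2] at h3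
          have b1 := a1.trans (Γ.r_comp _ _ h1).symm
          have b2 := a1'.trans (Γ.r_comp _ _ h2).symm
          obtain rfl := F.eq_of_fst hp hp' b1 b2 h3
          have h4 := Γ.left_cancel b1 b2 h3
          have h5 := congrArg (Γ.comp p.2) h4
          rw [← Γ.assoc _ _ _ hm.1 h1, ← Γ.assoc _ _ _ hm'.1 h2, hm.2.2.1, hm'.2.2.1] at h5
          have t1 := congrArg Γ.s hm.2.2.1
          rw [Γ.s_comp _ _ hm.1, Γ.s_comp _ _ hm.2.1] at t1
          have t2 := congrArg Γ.s hm'.2.2.1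
          rw [Γ.s_comp _ _ hm'.1, Γ.s_comp _ _ hm'.2.1] at t2
          rw [Γ.assoc _ _ _ hm.2.1 (t1 ▸ h1), Γ.assoc _ _ _ hm'.2.1 (t2 ▸ h2)] at h5
          obtain rfl := G.eq_of_fst hq hq' (hm.2.1.trans (Γ.r_comp _ _ (t1 ▸ h1)).symm)
            (hm'.2.1.trans (Γ.r_comp _ _ (t2 ▸ h2)).symm) h5
          have hd := deq rfl rfl hm hm'
          have k1 := (Γ.factor_inj h1 h2 h4 hd.1).1
          have k2 := Γ.left_cancel hm.2.1 hm'.2.1 (by rw [← hm.2.2.1, ← hm'.2.2.1, k1])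
          exact hne (by rw [k1, k2])
        · rw [Set.eq_empty_iff_forall_notMem]
          rintro ⟨c, c'⟩ ⟨h1, h2, h3, -⟩
          dsimp only at h1 h2 h3
          rw [s2] at h1
          rw [s2'] at h2
          rw [Γ.assoc _ _ _ a2 h1, Γ.assoc _ _ _ a2' h2] at h3
          have b1 := a2.trans (Γ.r_comp _ _ h1).symm
          have b2 := a2'.trans (Γ.r_comp _ _ h2).symm
          obtain rfl := G.eq_of_snd hq hq' b1 b2 h3
          have h4 := Γ.left_cancel b1 b2 h3
          have h5 := congrArg (Γ.comp q.1) h4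
          rw [← Γ.assoc _ _ _ hm.2.1 h1, ← Γ.assoc _ _ _ hm'.2.1 h2, ← hm.2.2.1, ← hm'.2.2.1] at h5
          have t1 := congrArg Γ.s hm.2.2.1
          rw [Γ.s_comp _ _ hm.1, Γ.s_comp _ _ hm.2.1] at t1
          have t2 := congrArg Γ.s hm'.2.2.1
          rw [Γ.s_comp _ _ hm'.1, Γ.s_comp _ _ hm'.2.1] at t2
          rw [Γ.assoc _ _ _ hm.1 (t1 ▸ h1), Γ.assoc _ _ _ hm'.1 (t2 ▸ h2)] at h5
          obtain rfl := F.eq_of_snd hp hp' (hm.1.trans (Γ.r_comp _ _ (t1 ▸ h1)).symm)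
            (hm'.1.trans (Γ.r_comp _ _ (t2 ▸ h2)).symm) h5
          have hd := deq rfl rfl hm hm'
          have k1 := (Γ.factor_inj h1 h2 h4 hd.2).1
          have k2 := Γ.left_cancel hm.1 hm'.1 (by rw [hm.2.2.1, hm'.2.2.1, k1])
          exact hne (by rw [k1, k2]) }

theorem mem_mul [Γ.FinitelyAligned] {F G : InvSemi Γ} {t : Λ × Λ} :
    t ∈ (F * G).carrier ↔ ∃ p ∈ F.carrier, ∃ q ∈ G.carrier, ∃ m ∈ Γ.minExt p.2 q.1,
        t = (Γ.comp p.1 m.1, Γ.comp q.2 m.2) := Iff.rfl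

/-- The partial bijection of `Λ` induced by `F`, as a relation: it sends `b g` to `a g`, for
`(a, b) ∈ F`. -/
def Act (F : InvSemi Γ) (x y : Λ) : Prop :=
  ∃ p ∈ F.carrier, ∃ g, Γ.s p.2 = Γ.r g ∧ x = Γ.comp p.1 g ∧ y = Γ.comp p.2 g

theorem act_fun {F : InvSemi Γ} {x x' y : Λ} (h : F.Act x y) (h' : F.Act x' y) : x = x' := by
  obtain ⟨p, hp, g, hg, rfl, rfl⟩ := h
  obtain ⟨q, hq, g', hg', rfl, e⟩ := h'
  obtain rfl := F.eq_of_snd hp hq hg hg' e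
  rw [Γ.left_cancel hg hg' e]

theorem act_star {F : InvSemi Γ} {x y : Λ} : F.star.Act x y ↔ F.Act y x := by
  constructor
  · rintro ⟨p, hp, g, hg, rfl, rfl⟩
    exact ⟨p.swap, hp, g, (F.s_eq _ hp).symm.trans hg, rfl, rfl⟩
  · rintro ⟨p, hp, g, hg, rfl, rfl⟩
    exact ⟨p.swap, hp, g, (F.s_eq _ hp).trans hg, rfl, rfl⟩

theorem act_inj {F : InvSemi Γ} {x y y' : Λ} (h : F.Act x y) (h' : F.Act x y') : y = y' :=
  act_fun (act_star.mpr h) (act_star.mpr h')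

theorem subset_of_act {F G : InvSemi Γ} (h : ∀ x y, F.Act x y ↔ G.Act x y) :
    F.carrier ⊆ G.carrier := by
  intro p hp
  have hs := F.s_eq p hp
  have h1 : F.Act p.1 p.2 := ⟨p, hp, Γ.s p.2, (Γ.r_s _).symm, by rw [← hs, Γ.comp_id],
    (Γ.comp_id _).symm⟩
  obtain ⟨q, hq, g, hg, e1, e2⟩ := (h _ _).mp h1
  have h2 : G.Act q.1 q.2 := ⟨q, hq, Γ.s q.2, (Γ.r_s _).symm, by rw [← G.s_eq q hq, Γ.comp_id],
    (Γ.comp_id _).symm⟩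
  obtain ⟨p', hp', g', hg', f1, f2⟩ := (h _ _).mpr h2
  have hgg : Γ.s g' = Γ.r g := by rw [← hg, f2, Γ.s_comp _ _ hg']
  have e3 : Γ.comp p.2 (Γ.s p.2) = Γ.comp p'.2 (Γ.comp g' g) := by
    rw [Γ.comp_id, ← Γ.assoc _ _ _ hg' hgg, ← f2, ← e2]
  have hg'' : Γ.s p'.2 = Γ.r (Γ.comp g' g) := by rw [Γ.r_comp _ _ hgg, hg']
  obtain rfl := F.eq_of_snd hp hp' (Γ.r_s _).symm hg'' e3
  have e4 := congrArg Γ.d (Γ.left_cancel (Γ.r_s _).symm hg'' e3)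
  rw [Γ.d_s, Γ.d_comp _ _ hgg] at e4
  have e5 : Γ.d g = 0 := by
    funext i
    have := congrFun e4 i
    simp only [Pi.zero_apply, Pi.add_apply] at this ⊢
    omega
  have e6 : g = Γ.s q.2 := by
    have := Γ.eq_s_of_d e5
    rw [this, Γ.r_s, ← this] at hg
    exact hg.symm
  rw [e6, Γ.comp_id] at e2
  rw [e6, ← G.s_eq q hq, Γ.comp_id] at e1
  have : p = q := Prod.ext e1 e2
  rwa [this]

theorem ext_act {F G : InvSemi Γ} (h : ∀ x y, F.Act x y ↔ G.Act x y) : F = G :=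
  InvSemi.ext ((subset_of_act h).antisymm (subset_of_act fun x y => (h x y).symm))

/-- The domain `D_F`: all `x` with `x(0, d(b)) = b` for some `(a, b) ∈ F`. -/
def D (F : InvSemi Γ) : Set (PathSpace Γ) :=
  {x | ∃ p ∈ F.carrier, x.Begins p.2}

/-- The map `θ_F`, defined on `D_F`: `θ_F(x) = a σ^{d(b)} x`, where `(a, b)` is the (unique) element
of `F` with `x(0, d(b)) = b`. -/
noncomputable def theta (F : InvSemi Γ) (x : PathSpace Γ)
    (hx : x ∈ F.D) : PathSpace Γ :=
  PathSpace.prepend hx.choose.1 (x.shift (Γ.d hx.choose.2) hx.choose_spec.2.1)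
    ((F.s_eq _ hx.choose_spec.1).trans hx.choose_spec.2.range_shift)

/-- The graph of `θ_F` as a relation: it sends `b z` to `a z`, for `(a, b) ∈ F`. -/
def PAct (F : InvSemi Γ) (y x : PathSpace Γ) : Prop :=
  ∃ p ∈ F.carrier, ∃ (z : PathSpace Γ) (h1 : Γ.s p.1 = z.range) (h2 : Γ.s p.2 = z.range),
    y = PathSpace.prepend p.1 z h1 ∧ x = PathSpace.prepend p.2 z h2

theorem pact_theta (F : InvSemi Γ) (x : PathSpace Γ) (hx : x ∈ F.D) : F.PAct (F.theta x hx) x :=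
  ⟨_, hx.choose_spec.1, _, _, hx.choose_spec.2.range_shift, rfl,
    (PathSpace.prepend_shift hx.choose_spec.2).symm⟩

theorem pact_fun {F : InvSemi Γ} {y y' x : PathSpace Γ} (h : F.PAct y x) (h' : F.PAct y' x) :
    y = y' := by
  obtain ⟨p, hp, z, h1, h2, rfl, rfl⟩ := h
  obtain ⟨q, hq, w, k1, k2, rfl, e⟩ := h'
  obtain rfl : p = q := by
    by_contra hne
    obtain ⟨m, hm, -⟩ := PathSpace.exists_min_path h2 k2 e
    rw [(F.perp p hp q hq hne).2] at hm
    exact hm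
  obtain rfl := PathSpace.prepend_inj e
  rfl

theorem PAct.mem {F : InvSemi Γ} {y x : PathSpace Γ} (h : F.PAct y x) : x ∈ F.D := by
  obtain ⟨p, hp, z, h1, h2, rfl, rfl⟩ := h
  exact ⟨p, hp, PathSpace.begins_prepend _ _ _⟩

theorem pact_iff {F : InvSemi Γ} {y x : PathSpace Γ} :
    F.PAct y x ↔ ∃ hx : x ∈ F.D, F.theta x hx = y :=
  ⟨fun h => ⟨h.mem, pact_fun (pact_theta _ _ _) h⟩, fun ⟨hx, h⟩ => h ▸ pact_theta F x hx⟩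

theorem pact_star {F : InvSemi Γ} {x y : PathSpace Γ} : F.star.PAct x y ↔ F.PAct y x := by
  constructor
  · rintro ⟨p, hp, g, h1, h2, rfl, rfl⟩
    exact ⟨p.swap, hp, g, h2, h1, rfl, rfl⟩
  · rintro ⟨p, hp, g, h1, h2, rfl, rfl⟩
    exact ⟨p.swap, hp, g, h2, h1, rfl, rfl⟩

theorem theta_mem_star (F : InvSemi Γ) (x : PathSpace Γ) (hx : x ∈ F.D) :
    F.theta x hx ∈ F.star.D :=
  (pact_star.mpr (pact_theta F x hx)).mem

/-- The idempotent `{(v, v)}` for the object `v = r(x)`. -/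
def idAt (x : PathSpace Γ) : InvSemi Γ :=
  single x.range x.range rfl

theorem mem_idAt (x : PathSpace Γ) : x ∈ (idAt x).D := by
  refine ⟨_, rfl, ?_⟩
  have e : Γ.d x.range = 0 := by
    unfold PathSpace.range PathSpace.vertex
    rw [PathSpace.d_seg, tsub_zero]
  exact ⟨by rw [e]; exact PathSpace.toInf_zero_le _, x.seg_congr rfl e⟩

variable [Γ.FinitelyAligned]

theorem act_mul {F G : InvSemi Γ} {x z : Λ} : (F * G).Act x z ↔ ∃ y, F.Act x y ∧ G.Act y z := by
  constructor
  · rintro ⟨t, ht, g, hg, rfl, rfl⟩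
    obtain ⟨p, hp, q, hq, m, hm, rfl⟩ := mem_mul.mp ht
    have a1 := (F.s_eq p hp).trans hm.1
    have a2 := (G.s_eq q hq).symm.trans hm.2.1
    dsimp only at hg
    rw [Γ.s_comp _ _ a2] at hg
    have t1 := congrArg Γ.s hm.2.2.1
    rw [Γ.s_comp _ _ hm.1, Γ.s_comp _ _ hm.2.1] at t1
    have hg1 : Γ.s m.1 = Γ.r g := t1.trans hg
    refine ⟨Γ.comp (Γ.comp p.2 m.1) g, ⟨p, hp, Γ.comp m.1 g, ?_, ?_, ?_⟩,
      ⟨q, hq, Γ.comp m.2 g, ?_, ?_, ?_⟩⟩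
    · rw [Γ.r_comp _ _ hg1]; exact hm.1
    · exact Γ.assoc _ _ _ a1 hg1
    · exact Γ.assoc _ _ _ hm.1 hg1
    · rw [Γ.r_comp _ _ hg]; exact a2
    · rw [hm.2.2.1]; exact Γ.assoc _ _ _ hm.2.1 hg
    · exact Γ.assoc _ _ _ a2 hg
  · rintro ⟨_, ⟨p, hp, g, hg, rfl, rfl⟩, ⟨q, hq, h, hh, e, rfl⟩⟩
    obtain ⟨m, hm, u, h1, h2, rfl, rfl⟩ :=
      Γ.exists_min hg ((G.s_eq q hq).trans hh) e
    have a1 := (F.s_eq p hp).trans hm.1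
    have a2 := (G.s_eq q hq).symm.trans hm.2.1
    refine ⟨_, mem_mul.mpr ⟨p, hp, q, hq, m, hm, rfl⟩, u, ?_, ?_, ?_⟩
    · dsimp only
      rw [Γ.s_comp _ _ a2, h2]
    · exact (Γ.assoc _ _ _ a1 h1).symm
    · exact (Γ.assoc _ _ _ a2 h2).symm

instance : Semigroup (InvSemi Γ) where
  mul_assoc F G H := by
    refine ext_act fun x y => ?_
    simp only [act_mul]
    constructor
    · rintro ⟨a, ⟨b, h1, h2⟩, h3⟩
      exact ⟨b, h1, a, h2, h3⟩
    · rintro ⟨b, h1, a, h2, h3⟩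
      exact ⟨a, ⟨b, h1, h2⟩, h3⟩

theorem isIdempotentElem_iff {P : InvSemi Γ} :
    IsIdempotentElem P ↔ ∀ x y, P.Act x y → x = y := by
  constructor
  · intro h x y hxy
    have h1 := hxy
    rw [← h.eq, act_mul] at h1
    obtain ⟨z, h2, h3⟩ := h1
    obtain rfl := act_inj h2 hxy
    exact act_fun hxy h3
  · intro h
    refine ext_act fun x y => ?_
    rw [act_mul]
    constructor
    · rintro ⟨z, h1, h2⟩
      rw [h _ _ h1]; exact h2
    · intro h1
      obtain rfl := h _ _ h1
      exact ⟨x, h1, h1⟩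

theorem idem_comm {P Q : InvSemi Γ} (hP : IsIdempotentElem P) (hQ : IsIdempotentElem Q) :
    P * Q = Q * P := by
  rw [isIdempotentElem_iff] at hP hQ
  refine ext_act fun x y => ?_
  rw [act_mul, act_mul]
  constructor
  · rintro ⟨z, h1, h2⟩
    obtain rfl := hP _ _ h1
    obtain rfl := hQ _ _ h2
    exact ⟨_, h2, h1⟩
  · rintro ⟨z, h1, h2⟩
    obtain rfl := hQ _ _ h1
    obtain rfl := hP _ _ h2
    exact ⟨_, h2, h1⟩

theorem idem_mul {P Q : InvSemi Γ} (hP : IsIdempotentElem P) (hQ : IsIdempotentElem Q) :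
    IsIdempotentElem (P * Q) := by
  rw [isIdempotentElem_iff] at *
  intro x y h
  obtain ⟨z, h1, h2⟩ := act_mul.mp h
  exact (hP _ _ h1).trans (hQ _ _ h2)

theorem idem_conj {P : InvSemi Γ} (hP : IsIdempotentElem P) (G : InvSemi Γ) :
    IsIdempotentElem (G.star * (P * G)) := by
  rw [isIdempotentElem_iff] at *
  intro x y h
  simp only [act_mul, act_star] at h
  obtain ⟨z, h1, w, h2, h3⟩ := h
  obtain rfl := hP _ _ h2
  exact act_inj h1 h3

theorem mul_conj {P : InvSemi Γ} (hP : IsIdempotentElem P) (G : InvSemi Γ) :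
    G * (G.star * (P * G)) = P * G := by
  rw [isIdempotentElem_iff] at hP
  refine ext_act fun x y => ?_
  simp only [act_mul, act_star]
  constructor
  · rintro ⟨a, h1, b, h2, c, h3, h4⟩
    obtain rfl := hP _ _ h3
    obtain rfl := act_fun h1 h2
    exact ⟨_, h3, h4⟩
  · rintro ⟨a, h1, h2⟩
    obtain rfl := hP _ _ h1
    exact ⟨y, h2, x, h2, x, h1, h2⟩

theorem pact_mul {F G : InvSemi Γ} {x z : PathSpace Γ} :
    (F * G).PAct x z ↔ ∃ y, F.PAct x y ∧ G.PAct y z := by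
  constructor
  · rintro ⟨t, ht, g, h1, h2, rfl, rfl⟩
    obtain ⟨p, hp, q, hq, m, hm, rfl⟩ := mem_mul.mp ht
    have a1 := (F.s_eq p hp).trans hm.1
    have a2 := (G.s_eq q hq).symm.trans hm.2.1
    dsimp only at h1 h2
    have g1 : Γ.s m.1 = g.range := by rw [← h1, Γ.s_comp _ _ a1]
    have g2 : Γ.s m.2 = g.range := by rw [← h2, Γ.s_comp _ _ a2]
    have r1 := PathSpace.range_prepend m.1 g g1
    have r2 := PathSpace.range_prepend m.2 g g2
    have h3 : Γ.s (Γ.comp p.2 m.1) = g.range := by rw [Γ.s_comp _ _ hm.1, g1]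
    have h4 : Γ.s (Γ.comp q.1 m.2) = g.range := by rw [Γ.s_comp _ _ hm.2.1, g2]
    refine ⟨PathSpace.prepend (Γ.comp p.2 m.1) g h3,
      ⟨p, hp, PathSpace.prepend m.1 g g1, a1.trans r1.symm, hm.1.trans r1.symm, ?_, ?_⟩,
      ⟨q, hq, PathSpace.prepend m.2 g g2, hm.2.1.trans r2.symm, a2.trans r2.symm, ?_, ?_⟩⟩
    · exact PathSpace.prepend_comp _ _ _ a1 g1 h1
    · exact PathSpace.prepend_comp _ _ _ hm.1 g1 h3
    · rw [← PathSpace.prepend_comp _ _ _ hm.2.1 g2 h4]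
      congr 1
      exact hm.2.2.1
    · exact PathSpace.prepend_comp _ _ _ a2 g2 h2
  · rintro ⟨_, ⟨p, hp, g, h1, h2, rfl, rfl⟩, ⟨q, hq, h, k1, k2, e, rfl⟩⟩
    obtain ⟨m, hm, u, l1, l2, rfl, rfl⟩ := PathSpace.exists_min_path h2 k1 e
    have a1 := (F.s_eq p hp).trans hm.1
    have a2 := (G.s_eq q hq).symm.trans hm.2.1
    refine ⟨_, mem_mul.mpr ⟨p, hp, q, hq, m, hm, rfl⟩, u, ?_, ?_, ?_, ?_⟩
    · dsimp only; rw [Γ.s_comp _ _ a1, l1]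
    · dsimp only; rw [Γ.s_comp _ _ a2, l2]
    · exact (PathSpace.prepend_comp _ _ _ a1 l1 _).symm
    · exact (PathSpace.prepend_comp _ _ _ a2 l2 _).symm

theorem pact_idem {P : InvSemi Γ} (hP : IsIdempotentElem P) {x y : PathSpace Γ} (h : P.PAct x y) :
    x = y := by
  have h1 := h
  rw [← hP.eq, pact_mul] at h1
  obtain ⟨z, h2, h3⟩ := h1
  obtain rfl := pact_fun (pact_star.mpr h2) (pact_star.mpr h)
  exact pact_fun h h3

theorem pact_self {P : InvSemi Γ} (hP : IsIdempotentElem P) {x : PathSpace Γ} (h : x ∈ P.D) :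
    P.PAct x x := by
  have h1 := pact_theta P x h
  have h2 := pact_idem hP h1
  rwa [h2] at h1

theorem idAt_idem (x : PathSpace Γ) : IsIdempotentElem (idAt x) := by
  rw [isIdempotentElem_iff]
  rintro a b ⟨p, rfl, g, hg, rfl, rfl⟩
  rfl

theorem mul_eq_iff {F G P : InvSemi Γ} (hP : IsIdempotentElem P) :
    F * P = G * P ↔ ∀ z a, P.Act a a → (F.Act z a ↔ G.Act z a) := by
  have hP' := isIdempotentElem_iff.mp hP
  constructor
  · intro h z a ha
    have key : ∀ H : InvSemi Γ, (H * P).Act z a ↔ H.Act z a := fun H => by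
      rw [act_mul]
      constructor
      · rintro ⟨y, h1, h2⟩
        obtain rfl := hP' _ _ h2
        exact h1
      · intro h1
        exact ⟨a, h1, ha⟩
    rw [← key F, ← key G, h]
  · intro h
    refine ext_act fun x y => ?_
    rw [act_mul, act_mul]
    constructor
    · rintro ⟨z, h1, h2⟩
      obtain rfl := hP' _ _ h2
      exact ⟨_, (h _ _ h2).mp h1, h2⟩
    · rintro ⟨z, h1, h2⟩
      obtain rfl := hP' _ _ h2
      exact ⟨_, (h _ _ h2).mpr h1, h2⟩

end InvSemi

/-- The set `Ξ_Λ` of pairs `(F, x)` with `F ∈ S_Λ` and `x ∈ D_F`. -/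
structure Xi {k : ℕ} {Λ : Type*} (Γ : KGraph k Λ) where
  F : InvSemi Γ
  x : PathSpace Γ
  mem : x ∈ F.D

section Germs

variable {k : ℕ} {Λ : Type*} (Γ : KGraph k Λ) [Γ.FinitelyAligned]

/-- The relation `(F, x) ∼ (G, y)`: `x = y` and there is an idempotent `P ∈ S_Λ` with `x ∈ D_P` and
`F P = G P`. -/
instance germSetoid : Setoid (Xi Γ) where
  r a b := a.x = b.x ∧ ∃ P : InvSemi Γ, IsIdempotentElem P ∧ a.x ∈ P.D ∧ a.F * P = b.F * P
  iseqv :=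
    { refl := fun a => ⟨rfl, _, InvSemi.idAt_idem a.x, InvSemi.mem_idAt a.x, rfl⟩
      symm := fun ⟨h, P, hP, hx, e⟩ => ⟨h.symm, P, hP, h ▸ hx, e.symm⟩
      trans := fun {a b c} ⟨h, P, hP, hx, e⟩ ⟨h', Q, hQ, hx', e'⟩ => by
        refine ⟨h.trans h', P * Q, InvSemi.idem_mul hP hQ, ?_, ?_⟩
        · exact (InvSemi.pact_mul.mpr ⟨_, InvSemi.pact_self hP hx,
            InvSemi.pact_self hQ (h ▸ hx')⟩).mem
        · calc a.F * (P * Q) = b.F * P * Q := by rw [← mul_assoc, e]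
            _ = b.F * Q * P := by rw [mul_assoc, InvSemi.idem_comm hP hQ, ← mul_assoc]
            _ = c.F * (P * Q) := by rw [e', mul_assoc, InvSemi.idem_comm hP hQ] }

/-- The set of germs `[F, x]`: the underlying set of the groupoid `G_Λ`. -/
def Germ := Quotient (germSetoid Γ)

variable {Γ}

theorem theta_congr {a b : Xi Γ} (h : a ≈ b) : a.F.theta a.x a.mem = b.F.theta b.x b.mem := by
  obtain ⟨F, x, hx⟩ := a
  obtain ⟨G, y, hy⟩ := b
  obtain ⟨rfl, P, hP, hxP, e⟩ := h
  have h1 : (F * P).PAct (F.theta x hx) x :=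
    InvSemi.pact_mul.mpr ⟨x, InvSemi.pact_theta _ _ _, InvSemi.pact_self hP hxP⟩
  have h2 : (G * P).PAct (G.theta x hy) x :=
    InvSemi.pact_mul.mpr ⟨x, InvSemi.pact_theta _ _ _, InvSemi.pact_self hP hxP⟩
  dsimp only at e
  rw [← e] at h2
  exact InvSemi.pact_fun h1 h2

theorem xi_mul_mem {a b : Xi Γ} (h : b.F.theta b.x b.mem = a.x) : b.x ∈ (a.F * b.F).D :=
  (InvSemi.pact_mul.mpr ⟨a.x, InvSemi.pact_theta _ _ a.mem, h ▸ InvSemi.pact_theta _ _ b.mem⟩).mem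

theorem xi_mul_congr {a a' b b' : Xi Γ} (ha : a ≈ a') (hb : b ≈ b')
    (h : b.F.theta b.x b.mem = a.x) (h' : b'.F.theta b'.x b'.mem = a'.x) :
    (⟨a.F * b.F, b.x, xi_mul_mem h⟩ : Xi Γ) ≈ ⟨a'.F * b'.F, b'.x, xi_mul_mem h'⟩ := by
  obtain ⟨-, P, hP, hxP, e⟩ := ha
  obtain ⟨hx, Q, hQ, hxQ, e'⟩ := hb
  have hbp : b.F.PAct a.x b.x := h ▸ InvSemi.pact_theta _ _ b.mem
  refine ⟨hx, Q * (b.F.star * (P * b.F)), InvSemi.idem_mul hQ (InvSemi.idem_conj hP _), ?_, ?_⟩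
  · refine InvSemi.PAct.mem (y := b.x) ?_
    simp only [InvSemi.pact_mul, InvSemi.pact_star]
    exact ⟨_, InvSemi.pact_self hQ hxQ, _, hbp, _, InvSemi.pact_self hP hxP, hbp⟩
  · rw [InvSemi.mul_eq_iff (InvSemi.idem_mul hQ (InvSemi.idem_conj hP _))]
    rw [InvSemi.mul_eq_iff hP] at e
    rw [InvSemi.mul_eq_iff hQ] at e'
    rw [InvSemi.isIdempotentElem_iff] at hP hQ
    intro z c hc
    simp only [InvSemi.act_mul, InvSemi.act_star] at hc ⊢
    obtain ⟨c1, h1, b1, h2, b2, h3, h4⟩ := hc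
    obtain rfl := hQ _ _ h1
    obtain rfl := hP _ _ h3
    constructor
    · rintro ⟨y, k1, k2⟩
      obtain rfl := InvSemi.act_fun k2 h4
      exact ⟨_, (e _ _ h3).mp k1, (e' _ _ h1).mp k2⟩
    · rintro ⟨y, k1, k2⟩
      have k3 := (e' _ _ h1).mpr k2
      obtain rfl := InvSemi.act_fun k3 h4
      exact ⟨_, (e _ _ h3).mpr k1, k3⟩

namespace Germ

/-- The germ `[F, x]`. -/
def mk (F : InvSemi Γ) (x : PathSpace Γ) (hx : x ∈ F.D) : Germ Γ := Quotient.mk _ ⟨F, x, hx⟩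

/-- The source of `[F, x]`, as a path: `x`. -/
def src (g : Germ Γ) : PathSpace Γ := Quotient.lift (fun a : Xi Γ => a.x) (fun a b (h : a ≈ b) => h.1) g

/-- The range of `[F, x]`, as a path: `θ_F(x)`. -/
noncomputable def tgt (g : Germ Γ) : PathSpace Γ :=
  Quotient.lift (fun a : Xi Γ => a.F.theta a.x a.mem) (fun _ _ h => theta_congr h) g

/-- The unit at `x`: the germ `[{(r(x), r(x))}, x]`. -/
def unit (x : PathSpace Γ) : Germ Γ := mk (InvSemi.idAt x) x (InvSemi.mem_idAt x)

open Classical in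
/-- The product `[F, θ_G(x)] [G, x] = [FG, x]` of germs. For germs that are not
composable the value is arbitrary. -/
noncomputable def mul (g h : Germ Γ) : Germ Γ :=
  Quotient.map₂ (fun a b : Xi Γ => if hab : b.F.theta b.x b.mem = a.x then
      ⟨a.F * b.F, b.x, xi_mul_mem hab⟩ else b)
    (fun a a' (ha : a ≈ a') b b' (hb : b ≈ b') => by
      have hx := ha.1
      have hth := theta_congr hb
      by_cases hab : b.F.theta b.x b.mem = a.x
      · have hab' : b'.F.theta b'.x b'.mem = a'.x := by rw [← hth, hab, hx]
        rw [dif_pos hab, dif_pos hab']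
        exact xi_mul_congr ha hb hab hab'
      · have hab' : ¬ b'.F.theta b'.x b'.mem = a'.x := by rw [← hth, ← hx]; exact hab
        rw [dif_neg hab, dif_neg hab']
        exact hb) g h

/-- The inverse `[F, x]⁻¹ = [F*, θ_F(x)]`. -/
noncomputable def inv (g : Germ Γ) : Germ Γ :=
  Quotient.map (fun a : Xi Γ => ⟨a.F.star, a.F.theta a.x a.mem, InvSemi.theta_mem_star a.F a.x a.mem⟩)
    (fun a b (hab : a ≈ b) => by
      have hth := theta_congr hab
      obtain ⟨-, P, hP, hxP, e⟩ := hab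
      have hpa := InvSemi.pact_theta _ _ a.mem
      have hidem : IsIdempotentElem (a.F.star.star * (P * a.F.star)) := InvSemi.idem_conj hP _
      refine ⟨hth, _, hidem, ?_, ?_⟩
      · refine InvSemi.PAct.mem (y := a.F.theta a.x a.mem) ?_
        simp only [InvSemi.pact_mul, InvSemi.pact_star]
        exact ⟨_, hpa, _, InvSemi.pact_self hP hxP, hpa⟩
      · rw [InvSemi.mul_eq_iff hidem]
        rw [InvSemi.mul_eq_iff hP] at e
        rw [InvSemi.isIdempotentElem_iff] at hP
        intro z c hc
        simp only [InvSemi.act_mul, InvSemi.act_star] at hc ⊢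
        obtain ⟨u, h1, v, h2, h3⟩ := hc
        obtain rfl := hP _ _ h2
        constructor
        · intro h4
          obtain rfl := InvSemi.act_inj h4 h1
          exact (e _ _ h2).mp h4
        · intro h4
          have h5 := (e _ _ h2).mp h1
          obtain rfl := InvSemi.act_inj h4 h5
          exact h1) g

theorem src_mk (F : InvSemi Γ) (x : PathSpace Γ) (hx : x ∈ F.D) : (mk F x hx).src = x := rfl

theorem tgt_mk (F : InvSemi Γ) (x : PathSpace Γ) (hx : x ∈ F.D) :
    (mk F x hx).tgt = F.theta x hx := rfl

theorem inv_mk (F : InvSemi Γ) (x : PathSpace Γ) (hx : x ∈ F.D) :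
    (mk F x hx).inv = mk F.star (F.theta x hx) (InvSemi.theta_mem_star F x hx) := rfl

theorem exists_mk (g : Germ Γ) : ∃ F x hx, g = mk F x hx := by
  induction g using Quotient.inductionOn with
  | h a => exact ⟨a.F, a.x, a.mem, rfl⟩

theorem mk_eq {F G P : InvSemi Γ} {x : PathSpace Γ} {hx : x ∈ F.D} {hy : x ∈ G.D}
    (hP : IsIdempotentElem P) (hxP : x ∈ P.D) (e : F * P = G * P) : mk F x hx = mk G x hy :=
  Quotient.sound ⟨rfl, P, hP, hxP, e⟩

theorem mul_mk (F G : InvSemi Γ) (x y : PathSpace Γ) (hy : y ∈ F.D) (hx : x ∈ G.D)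
    (h : G.theta x hx = y) :
    mul (mk F y hy) (mk G x hx) =
      mk (F * G) x (xi_mul_mem (a := ⟨F, y, hy⟩) (b := ⟨G, x, hx⟩) h) :=
  congrArg (Quotient.mk (germSetoid Γ)) (dif_pos h)

theorem unit_eq {P : InvSemi Γ} {x : PathSpace Γ} (hP : IsIdempotentElem P) (hx : x ∈ P.D) :
    mk P x hx = unit x := by
  have hQ := InvSemi.idAt_idem x
  refine mk_eq (InvSemi.idem_mul hP hQ) (InvSemi.pact_mul.mpr ⟨_, InvSemi.pact_self hP hx,
    InvSemi.pact_self hQ (InvSemi.mem_idAt x)⟩).mem ?_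
  rw [← mul_assoc, hP.eq, InvSemi.idem_comm hP hQ, ← mul_assoc, hQ.eq]

theorem src_unit (x : PathSpace Γ) : (unit x).src = x := rfl

theorem tgt_unit (x : PathSpace Γ) : (unit x).tgt = x :=
  InvSemi.pact_idem (InvSemi.idAt_idem x) (InvSemi.pact_theta _ _ _)

theorem unit_inj {x y : PathSpace Γ} (h : unit x = unit y) : x = y := congrArg src h

theorem src_mul {g h : Germ Γ} (hgh : g.src = h.tgt) : (mul g h).src = h.src := by
  obtain ⟨F, y, hy, rfl⟩ := g.exists_mk
  obtain ⟨G, x, hx, rfl⟩ := h.exists_mk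
  rw [mul_mk F G x y hy hx hgh.symm]
  rfl

theorem tgt_mul {g h : Germ Γ} (hgh : g.src = h.tgt) : (mul g h).tgt = g.tgt := by
  obtain ⟨F, y, hy, rfl⟩ := g.exists_mk
  obtain ⟨G, x, hx, rfl⟩ := h.exists_mk
  have e : G.theta x hx = y := hgh.symm
  subst e
  rw [mul_mk _ _ _ _ _ _ rfl, tgt_mk, tgt_mk]
  exact InvSemi.pact_fun (InvSemi.pact_theta _ _ _)
    (InvSemi.pact_mul.mpr ⟨_, InvSemi.pact_theta _ _ _, InvSemi.pact_theta _ _ _⟩)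

theorem src_inv (g : Germ Γ) : g.inv.src = g.tgt := by
  obtain ⟨F, y, hy, rfl⟩ := g.exists_mk
  rfl

theorem tgt_inv (g : Germ Γ) : g.inv.tgt = g.src := by
  obtain ⟨F, y, hy, rfl⟩ := g.exists_mk
  exact InvSemi.pact_fun (InvSemi.pact_theta _ _ _)
    (InvSemi.pact_star.mpr (InvSemi.pact_theta _ _ _))

theorem mul_assoc' {f g h : Germ Γ} (h1 : f.src = g.tgt) (h2 : g.src = h.tgt) :
    mul (mul f g) h = mul f (mul g h) := by
  have h3 : (mul f g).src = h.tgt := (src_mul h1).trans h2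
  have h4 : f.src = (mul g h).tgt := h1.trans (tgt_mul h2).symm
  obtain ⟨F, z, hz, rfl⟩ := f.exists_mk
  obtain ⟨G, y, hy, rfl⟩ := g.exists_mk
  obtain ⟨H, x, hx, rfl⟩ := h.exists_mk
  rw [mul_mk F G y z hz hy h1.symm] at h3 ⊢
  rw [mul_mk G H x y hy hx h2.symm] at h4 ⊢
  rw [mul_mk (F * G) H x y _ hx h3.symm, mul_mk F (G * H) x z hz _ h4.symm]
  exact mk_eq (InvSemi.idAt_idem x) (InvSemi.mem_idAt x) (by rw [mul_assoc F G H])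

theorem unit_mul (g : Germ Γ) : mul (unit g.tgt) g = g := by
  obtain ⟨F, x, hx, rfl⟩ := g.exists_mk
  rw [tgt_mk]
  unfold unit
  rw [mul_mk _ F x (F.theta x hx) _ hx rfl]
  have hV := InvSemi.idAt_idem (F.theta x hx)
  have hF := InvSemi.pact_theta F x hx
  have hP := InvSemi.idem_conj hV F
  refine mk_eq hP ?_ ?_
  · refine InvSemi.PAct.mem (y := x) ?_
    simp only [InvSemi.pact_mul, InvSemi.pact_star]
    exact ⟨_, hF, _, InvSemi.pact_self hV (InvSemi.mem_idAt _), hF⟩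
  · have e := InvSemi.mul_conj hV F
    calc _ = F * (F.star * (InvSemi.idAt (F.theta x hx) * F)) *
          (F.star * (InvSemi.idAt (F.theta x hx) * F)) := by rw [e]
      _ = _ := by rw [mul_assoc F, hP.eq]

theorem mul_unit (g : Germ Γ) : mul g (unit g.src) = g := by
  obtain ⟨F, x, hx, rfl⟩ := g.exists_mk
  rw [src_mk]
  unfold unit
  rw [mul_mk F _ x x hx _ (tgt_unit x)]
  refine mk_eq (InvSemi.idAt_idem x) (InvSemi.mem_idAt x) ?_
  rw [mul_assoc, (InvSemi.idAt_idem x).eq]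

theorem mul_inv (g : Germ Γ) : mul g g.inv = unit g.tgt := by
  have h := tgt_inv g
  obtain ⟨F, x, hx, rfl⟩ := g.exists_mk
  rw [inv_mk, mul_mk F _ _ x hx _ h]
  refine unit_eq ?_ _
  rw [InvSemi.isIdempotentElem_iff]
  intro a b hab
  obtain ⟨c, h1, h2⟩ := InvSemi.act_mul.mp hab
  exact InvSemi.act_fun h1 (InvSemi.act_star.mp h2)

theorem inv_mul (g : Germ Γ) : mul g.inv g = unit g.src := by
  obtain ⟨F, x, hx, rfl⟩ := g.exists_mk
  rw [inv_mk, mul_mk _ _ _ _ _ _ rfl]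
  refine unit_eq ?_ _
  rw [InvSemi.isIdempotentElem_iff]
  intro a b hab
  obtain ⟨c, h1, h2⟩ := InvSemi.act_mul.mp hab
  exact InvSemi.act_inj (InvSemi.act_star.mp h1) h2

end Germ

end Germs

end KGraph

/-- A groupoid with set of arrows `G`, in the arrows-only convention: the units are the arrows of the
form `r g = g g⁻¹` (equivalently `s g = g⁻¹ g`), and `g h` is defined if `s g = r h`. -/
structure ArrowGroupoid (G : Type*) where
  r : G → G
  s : G → G
  mul : (g h : G) → s g = r h → G
  inv : G → G
  r_r : ∀ g, r (r g) = r g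
  s_r : ∀ g, s (r g) = r g
  r_s : ∀ g, r (s g) = s g
  s_s : ∀ g, s (s g) = s g
  r_mul : ∀ g h e, r (mul g h e) = r g
  s_mul : ∀ g h e, s (mul g h e) = s h
  assoc : ∀ f g h (e : s f = r g) (e' : s g = r h),
    mul (mul f g e) h ((s_mul f g e).trans e') = mul f (mul g h e') (e.trans (r_mul g h e').symm)
  r_mul_self : ∀ g, mul (r g) g (s_r g) = g
  mul_s_self : ∀ g, mul g (s g) (r_s g).symm = g
  r_inv : ∀ g, r (inv g) = s g
  s_inv : ∀ g, s (inv g) = r g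
  mul_inv : ∀ g, mul g (inv g) (r_inv g).symm = r g
  inv_mul : ∀ g, mul (inv g) g (s_inv g) = s g

namespace ArrowGroupoid

variable {G : Type*} (𝒢 : ArrowGroupoid G)

/-- The unit space `G^(0)`. -/
def units : Set G := {u | 𝒢.r u = u}

/-- The arrows of the reduction `G|_U`: those with range and source in `U`. -/
def reductionSet (U : Set G) : Set G := {g | 𝒢.r g ∈ U ∧ 𝒢.s g ∈ U}

theorem mem_reductionSet {U : Set G} {g : G} :
    g ∈ 𝒢.reductionSet U ↔ 𝒢.r g ∈ U ∧ 𝒢.s g ∈ U := Iff.rfl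

/-- The reduction `G|_U` of `G` to a set `U` of units. -/
def reduction (U : Set G) : ArrowGroupoid (𝒢.reductionSet U) where
  r g := ⟨𝒢.r g, by rw [mem_reductionSet, 𝒢.r_r, 𝒢.s_r]; exact ⟨g.2.1, g.2.1⟩⟩
  s g := ⟨𝒢.s g, by rw [mem_reductionSet, 𝒢.r_s, 𝒢.s_s]; exact ⟨g.2.2, g.2.2⟩⟩
  mul g h e := ⟨𝒢.mul g h (congrArg Subtype.val e), by
    rw [mem_reductionSet, 𝒢.r_mul, 𝒢.s_mul]; exact ⟨g.2.1, h.2.2⟩⟩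
  inv g := ⟨𝒢.inv g, by
    rw [mem_reductionSet, 𝒢.r_inv, 𝒢.s_inv]; exact ⟨g.2.2, g.2.1⟩⟩
  r_r g := Subtype.ext (𝒢.r_r g)
  s_r g := Subtype.ext (𝒢.s_r g)
  r_s g := Subtype.ext (𝒢.r_s g)
  s_s g := Subtype.ext (𝒢.s_s g)
  r_mul g h e := Subtype.ext (𝒢.r_mul _ _ _)
  s_mul g h e := Subtype.ext (𝒢.s_mul _ _ _)
  assoc f g h e e' := Subtype.ext (𝒢.assoc _ _ _ _ _)
  r_mul_self g := Subtype.ext (𝒢.r_mul_self g)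
  mul_s_self g := Subtype.ext (𝒢.mul_s_self g)
  r_inv g := Subtype.ext (𝒢.r_inv g)
  s_inv g := Subtype.ext (𝒢.s_inv g)
  mul_inv g := Subtype.ext (𝒢.mul_inv g)
  inv_mul g := Subtype.ext (𝒢.inv_mul g)

/-- The unit `u` has trivial isotropy: `u` is the only arrow with range and source `u`. -/
def HasTrivialIsotropy (u : 𝒢.units) : Prop := ∀ g, 𝒢.r g = u → 𝒢.s g = u → g = u

/-- A groupoid with a topology on its arrows is essentially free if the units with trivial isotropy
are dense in the unit space (with the subspace topology). -/
def IsEssentiallyFree [TopologicalSpace G] : Prop := Dense {u : 𝒢.units | 𝒢.HasTrivialIsotropy u}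

end ArrowGroupoid

namespace KGraph

variable {k : ℕ} {Λ : Type*} (Γ : KGraph k Λ) [Γ.FinitelyAligned]

/-- The groupoid `G_Λ` of germs of the action of `S_Λ` on `X_Λ`. -/
noncomputable def germGroupoid : ArrowGroupoid (Germ Γ) where
  r g := Germ.unit g.tgt
  s g := Germ.unit g.src
  mul g h _ := g.mul h
  inv := Germ.inv
  r_r g := by rw [Germ.tgt_unit]
  s_r g := by rw [Germ.src_unit]
  r_s g := by rw [Germ.tgt_unit]
  s_s g := by rw [Germ.src_unit]
  r_mul g h e := by rw [Germ.tgt_mul (Germ.unit_inj e)]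
  s_mul g h e := by rw [Germ.src_mul (Germ.unit_inj e)]
  assoc f g h e e' := Germ.mul_assoc' (Germ.unit_inj e) (Germ.unit_inj e')
  r_mul_self := Germ.unit_mul
  mul_s_self := Germ.mul_unit
  r_inv g := by rw [Germ.tgt_inv]
  s_inv g := by rw [Germ.src_inv]
  mul_inv := Germ.mul_inv
  inv_mul := Germ.inv_mul

variable {Γ} in
/-- The set `Ψ(F)` of germs `[F, x]` with `x ∈ D_F`. -/
def Psi (F : InvSemi Γ) : Set (Germ Γ) := {g | ∃ x hx, g = Germ.mk F x hx}

/-- The topology of `G_Λ`: the sets `Ψ(F)` and their complements form a subbasis. -/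
instance : TopologicalSpace (Germ Γ) :=
  TopologicalSpace.generateFrom {A | ∃ F : InvSemi Γ, A = Psi F ∨ A = (Psi F)ᶜ}

/-- The boundary-path space `∂Λ`, as a set of units of `G_Λ` (the path `x` being identified
with the unit at `x`). -/
def boundary : Set (Germ Γ) := {g | ∃ x : PathSpace Γ, x.IsBoundary ∧ g = Germ.unit x}

/-- The boundary groupoid `G_Λ|_{∂Λ}`, on a set of arrows that carries the subspace topology. -/
noncomputable def boundaryGroupoid : ArrowGroupoid (Γ.germGroupoid.reductionSet Γ.boundary) :=
  Γ.germGroupoid.reduction Γ.boundary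

end KGraph

/-!
The proof translates essential freeness into a statement about paths. If a germ `[F, x]` has source
and range `x`, then `F` contains a pair `(a, b)` with `a z = x = b z` for some path `z`, and the germ
is a unit if and only if `a = b` (`Germ.mk_eq_unit_iff`). As `a` and `b` are both initial segments of
`x`, this happens as soon as `d(a) = d(b)`. So the isotropy at `x` is trivial if and only if `x` is
aperiodic, that is, `σ^m x = σ^n x` implies `m = n` (`isAperiodic_iff_germ`). Moreover, the unit at
`x` lies in `Ψ(F)` if and only if `x` begins with some `μ` such that `(μ, μ) ∈ F`
(`unit_mem_Psi_iff`). Hence a unit has a neighbourhood basis of sets `Z(μ) \ ⋃ Z(ν)`, where `Z(μ)`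
is the set of paths that begin with `μ` and `ν` runs through a finite set (`exists_cylinder`), and
the proposition says that every object is the range of an aperiodic boundary path if and only if such
paths are dense in `∂Λ` (`isEssentiallyFree_iff`).

Density implies condition (A) because every object `v` is the range of some boundary path
(`PathSpace.exists_isBoundary`): there are countably many requirements in the definition of a
boundary path, and each can be met by extending a given finite path, so that a sequence of successive
extensions converges to a boundary path.

Conversely, let `x ∈ ∂Λ` begin with `μ` but with no `ν` in the finite set `N`. Let `E` be the set of
all `α` that occur in some `(α, β) ∈ Λ^min(μ, ν)` with `ν ∈ N`; it is finite by finite alignment. As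
`x = μ z` and `z` begins with no element of `E`, the set `E` is not exhaustive, so that
`Λ^min(α, c) = ∅` for some `c` with `r(c) = s(μ)` and all `α ∈ E`. If `y` is an aperiodic boundary
path with range `s(c)`, then `μ c y` is an aperiodic boundary path as well
(`PathSpace.IsBoundary.prepend`, `PathSpace.IsAperiodic.prepend`), and it begins with no `ν ∈ N`.
-/

namespace KGraph

variable {k : ℕ} {Λ : Type*} {Γ : KGraph k Λ}

/-! ### Minimal common extensions and the extension preorder -/

theorem minExt_nonempty_symm {a b : Λ} (h : (Γ.minExt a b).Nonempty) :
    (Γ.minExt b a).Nonempty := by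
  obtain ⟨⟨α, β⟩, h1, h2, h3, h4⟩ := h
  exact ⟨(β, α), h2, h1, h3.symm, by rw [sup_comm, ← h4, h3]⟩

theorem minExt_nonempty_of_comp_eq {a b g h : Λ} (hg : Γ.s a = Γ.r g) (hh : Γ.s b = Γ.r h)
    (e : Γ.comp a g = Γ.comp b h) : (Γ.minExt a b).Nonempty := by
  obtain ⟨p, hp, -⟩ := Γ.exists_min hg hh e
  exact ⟨p, hp⟩

/-- The set `Ext(b; E)` of the first components of the elements of `Λ^min(b, e)`, for `e ∈ E`. -/
def extSet (Γ : KGraph k Λ) (b : Λ) (E : Set Λ) : Set Λ :=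
  {α | ∃ e ∈ E, ∃ β, (α, β) ∈ Γ.minExt b e}

theorem finite_extSet [Γ.FinitelyAligned] (b : Λ) {E : Set Λ} (hE : E.Finite) :
    (Γ.extSet b E).Finite := by
  refine (hE.biUnion fun e _ => (FinitelyAligned.finite_minExt (Γ := Γ) b e).image Prod.fst).subset ?_
  rintro α ⟨e, he, β, h⟩
  exact Set.mem_biUnion he ⟨(α, β), h, rfl⟩

/-- Exhaustive sets pull back along paths. -/
theorem IsFiniteExhaustive.extSet [Γ.FinitelyAligned] {v b : Λ} {E : Set Λ}
    (hE : Γ.IsFiniteExhaustive v E) (hb : Γ.r b = v) :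
    Γ.IsFiniteExhaustive (Γ.s b) (Γ.extSet b E) := by
  refine ⟨finite_extSet b hE.1, ?_, fun c hc => ?_⟩
  · rintro α ⟨e, he, β, h⟩
    exact h.1.symm
  · obtain ⟨e, he, ⟨g, h⟩, h1, h2, h3, -⟩ := hE.2.2 (Γ.comp b c) (by rw [Γ.r_comp _ _ hc.symm, hb])
    rw [Γ.s_comp _ _ hc.symm] at h2
    dsimp only at h1 h2 h3
    rw [Γ.assoc _ _ _ hc.symm h2] at h3
    obtain ⟨⟨α, β⟩, hp, u, k1, k2, k3, -⟩ :=
      Γ.exists_min (hc.symm.trans (Γ.r_comp _ _ h2).symm) h1 h3.symm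
    exact ⟨α, ⟨e, he, β, hp⟩, minExt_nonempty_of_comp_eq k1 h2 k3.symm⟩

/-- The path `b` extends the path `a`. -/
def Extends (Γ : KGraph k Λ) (a b : Λ) : Prop := ∃ g, Γ.s a = Γ.r g ∧ Γ.comp a g = b

theorem Extends.refl (a : Λ) : Γ.Extends a a := ⟨Γ.s a, (Γ.r_s a).symm, Γ.comp_id a⟩

theorem Extends.trans {a b c : Λ} (h : Γ.Extends a b) (h' : Γ.Extends b c) : Γ.Extends a c := by
  obtain ⟨g, hg, rfl⟩ := h
  obtain ⟨g', hg', rfl⟩ := h'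
  rw [Γ.s_comp _ _ hg] at hg'
  exact ⟨Γ.comp g g', by rw [Γ.r_comp _ _ hg', hg], (Γ.assoc _ _ _ hg hg').symm⟩

theorem Extends.d_le {a b : Λ} (h : Γ.Extends a b) : Γ.d a ≤ Γ.d b := by
  obtain ⟨g, hg, rfl⟩ := h
  rw [Γ.d_comp _ _ hg]
  exact le_self_add

theorem Extends.eq_of_d {a b c : Λ} (ha : Γ.Extends a c) (hb : Γ.Extends b c)
    (h : Γ.d a = Γ.d b) : a = b := by
  obtain ⟨g, hg, rfl⟩ := ha
  obtain ⟨g', hg', e⟩ := hb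
  exact (Γ.factor_inj hg hg' e.symm h).1

theorem Extends.of_d_le {a b c : Λ} (ha : Γ.Extends a c) (hb : Γ.Extends b c)
    (h : Γ.d a ≤ Γ.d b) : Γ.Extends a b := by
  obtain ⟨a', g, hg, e, hd⟩ := Γ.exists_factor b h
  have ha' : Γ.Extends a' b := ⟨g, hg, e⟩
  obtain rfl := ha.eq_of_d (ha'.trans hb) hd.symm
  exact ha'

/-- The preorder of extension on the set of paths. -/
@[reducible]
def extPreorder (Γ : KGraph k Λ) : Preorder Λ where
  le := Γ.Extends
  le_refl := Extends.refl
  le_trans _ _ _ := Extends.trans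

namespace PathSpace

/-! ### Initial segments of paths -/

variable {x y z w : PathSpace Γ} {a b : Λ}

theorem prepend_congr (e : a = b) (e' : z = w) (ha : Γ.s a = z.range) :
    prepend a z ha = prepend b w (e ▸ e' ▸ ha) := by
  subst e; subst e'; rfl

theorem begins_iff : x.Begins a ↔ ∃ z h, prepend a z h = x := by
  constructor
  · exact fun h => ⟨_, _, prepend_shift h⟩
  · rintro ⟨z, h, rfl⟩
    exact begins_prepend a z h

theorem Begins.of_extends (h : x.Begins b) (hab : Γ.Extends a b) : x.Begins a := by
  obtain ⟨g, hg, rfl⟩ := hab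
  obtain ⟨z, hz, rfl⟩ := begins_iff.mp h
  rw [prepend_comp a g z hg (by rw [← hz, Γ.s_comp _ _ hg]) hz]
  exact begins_prepend _ _ _

theorem begins_prepend_comp_iff {g : Λ} (hg : Γ.s a = Γ.r g) (hz : Γ.s a = z.range) :
    (prepend a z hz).Begins (Γ.comp a g) ↔ z.Begins g := by
  constructor
  · intro h
    obtain ⟨w, hw, e⟩ := begins_iff.mp h
    rw [prepend_comp a g w hg (by rw [← hw, Γ.s_comp _ _ hg])] at e
    rw [← prepend_inj e]
    exact begins_prepend _ _ _
  · intro h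
    obtain ⟨w, hw, rfl⟩ := begins_iff.mp h
    rw [← prepend_comp a g w hg hw (by rw [Γ.s_comp _ _ hg, hw])]
    exact begins_prepend _ _ _

theorem Begins.eq_of_d (ha : x.Begins a) (hb : x.Begins b) (h : Γ.d a = Γ.d b) : a = b := by
  obtain ⟨h1, e1⟩ := ha
  obtain ⟨h2, e2⟩ := hb
  rw [← e1, ← e2]
  exact x.seg_congr rfl h

theorem exists_begins (x : PathSpace Γ) {n : Fin k → ℕ} (hn : toInf n ≤ x.deg) :
    ∃ a, Γ.d a = n ∧ x.Begins a := by
  obtain ⟨u, t, h, rfl, e⟩ := x.exists_split n hn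
  exact ⟨_, by rw [d_seg, tsub_zero], begins_iff.mpr ⟨u, h, e⟩⟩

theorem begins_range (x : PathSpace Γ) : x.Begins x.range := by
  obtain ⟨_, rfl, h⟩ := InvSemi.mem_idAt x
  exact h

theorem Begins.range_eq (h : x.Begins a) : x.range = Γ.r a := by
  obtain ⟨z, hz, rfl⟩ := begins_iff.mp h
  exact range_prepend a z hz

theorem Begins.exists_extends (ha : x.Begins a) (hb : x.Begins b) :
    ∃ c, x.Begins c ∧ Γ.Extends a c ∧ Γ.Extends b c := by
  obtain ⟨z, hz, rfl⟩ := begins_iff.mp ha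
  obtain ⟨w, hw, e⟩ := begins_iff.mp hb
  obtain ⟨⟨α, β⟩, hm, u, h1, h2, rfl, rfl⟩ := exists_min_path hz hw e.symm
  exact ⟨Γ.comp a α, (begins_prepend_comp_iff hm.1 hz).mpr (begins_prepend _ _ _),
    ⟨α, hm.1, rfl⟩, ⟨β, hm.2.1, hm.2.2.1.symm⟩⟩

theorem exists_prepend_shift (x : PathSpace Γ) (n : Fin k → ℕ) (hn : toInf n ≤ x.deg) :
    ∃ a, Γ.d a = n ∧ ∃ h, prepend a (x.shift n hn) h = x := by
  obtain ⟨a, rfl, ha⟩ := x.exists_begins hn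
  exact ⟨a, rfl, ha.range_shift, prepend_shift ha⟩

/-! ### Boundary paths and aperiodic paths -/

/-- The boundary condition, with `x(n, n + d(e)) = e` read as a property of the tail `σ^n x`. -/
theorem isBoundary_iff : x.IsBoundary ↔ ∀ a z h, prepend a z h = x →
    ∀ E, Γ.IsFiniteExhaustive (Γ.s a) E → ∃ e ∈ E, z.Begins e := by
  have key : ∀ n (hn : toInf n ≤ x.deg) e,
      (∃ h : toInf (n + Γ.d e) ≤ x.deg, x.seg n (n + Γ.d e) le_self_add h = e) ↔
        (x.shift n hn).Begins e := by
    intro n hn e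
    constructor
    · rintro ⟨h, he⟩
      obtain ⟨a, rfl, ha, hx⟩ := x.exists_prepend_shift n hn
      have hle : toInf (Γ.d e) ≤ x.deg - toInf (Γ.d a) := by
        have := sub_le_deg (q := Γ.d a + Γ.d e) (n := Γ.d a) (m := x.deg - toInf (Γ.d a))
          (by rw [add_tsub_cancel_of_le hn]; exact h)
        rwa [add_tsub_cancel_left] at this
      exact ⟨hle, (x.seg_congr (zero_add _) (add_comm _ _)).trans he⟩
    · rintro ⟨h, he⟩
      have hle := add_le_of_le_sub hn h
      rw [add_comm] at hle
      exact ⟨hle, (x.seg_congr (zero_add _).symm (add_comm _ _)).trans he⟩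
  constructor
  · rintro H a z h rfl E hE
    have hn : toInf (Γ.d a) ≤ (prepend a z h).deg := (begins_prepend a z h).1
    have e := shift_prepend a z h hn
    obtain ⟨c, hc, h'⟩ := H (Γ.d a) hn E (by
      rw [← range_shift, e, ← h]; exact hE)
    rw [key _ hn, e] at h'
    exact ⟨c, hc, h'⟩
  · intro H n hn E hE
    obtain ⟨a, -, h, hx⟩ := x.exists_prepend_shift n hn
    obtain ⟨e, he, h'⟩ := H a _ h hx E (by rw [h, range_shift]; exact hE)
    exact ⟨e, he, (key _ hn _).mpr h'⟩

theorem IsBoundary.prepend [Γ.FinitelyAligned] (hx : x.IsBoundary) (h : Γ.s a = x.range) :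
    (prepend a x h).IsBoundary := by
  rw [isBoundary_iff] at hx ⊢
  intro b z hz e E hE
  obtain ⟨⟨α, β⟩, hm, u, h1, h2, hxu, rfl⟩ := exists_min_path h hz e.symm
  have hs : Γ.s α = Γ.s β := h1.trans h2.symm
  obtain ⟨γ, ⟨c, hc, δ, hγ⟩, hu⟩ := hx α u h1 hxu.symm (Γ.extSet β E) (by
    rw [hs]; exact hE.extSet hm.2.1.symm)
  exact ⟨c, hc, ((begins_prepend_comp_iff hγ.1 h2).mpr hu).of_extends ⟨δ, hγ.2.1, hγ.2.2.1.symm⟩⟩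

/-- A path is aperiodic if none of its tails occurs at two different degrees. -/
def IsAperiodic (x : PathSpace Γ) : Prop :=
  ∀ a b z ha hb, prepend a z ha = x → prepend b z hb = x → Γ.d a = Γ.d b

theorem isAperiodic_iff : x.IsAperiodic ↔ ∀ (m n : Fin k → ℕ) (hm : toInf m ≤ x.deg)
    (hn : toInf n ≤ x.deg), x.shift m hm = x.shift n hn → m = n := by
  constructor
  · intro H m n hm hn e
    obtain ⟨a, rfl, ha, h1⟩ := x.exists_prepend_shift m hm
    obtain ⟨b, rfl, hb, h2⟩ := x.exists_prepend_shift n hn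
    exact H a b _ ha (e ▸ hb) h1 ((prepend_congr rfl e _).trans h2)
  · intro H a b z ha hb h1 h2
    have key : ∀ c (hc : Γ.s c = z.range) (h : prepend c z hc = x),
        ∃ h' : toInf (Γ.d c) ≤ x.deg, x.shift (Γ.d c) h' = z := by
      rintro c hc rfl
      exact ⟨(begins_prepend c z hc).1, shift_prepend c z hc _⟩
    obtain ⟨k1, k2⟩ := key a ha h1
    obtain ⟨l1, l2⟩ := key b hb h2
    exact H _ _ k1 l1 (k2.trans l2.symm)

/-- If `a x = b z = c z`, then passing to a common tail of `x` and `z` yields two equal tails of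
`x`, whose degrees differ by `d(b) - d(c)`. -/
theorem IsAperiodic.prepend (hx : x.IsAperiodic) (h : Γ.s a = x.range) :
    (prepend a x h).IsAperiodic := by
  intro b c z hb hc e1 e2
  obtain ⟨⟨α, β⟩, hm, u, h1, h2, rfl, rfl⟩ := exists_min_path h hb e1.symm
  obtain ⟨⟨α', β'⟩, hm', u', h1', h2', e3, e4⟩ := exists_min_path h hc e2.symm
  dsimp only at *
  obtain ⟨⟨γ, γ'⟩, hn, w, k1, k2, rfl, rfl⟩ := exists_min_path h2 h2' e4
  dsimp only at *
  rw [range_prepend] at h1 h2 h1' h2'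
  have hw : Γ.s (Γ.comp α γ) = w.range := by rw [Γ.s_comp _ _ h1, k1]
  have hw' : Γ.s (Γ.comp α' γ') = w.range := by rw [Γ.s_comp _ _ h1', k2]
  have hd := hx _ _ w hw hw' (prepend_comp _ _ _ h1 k1 _)
    ((prepend_comp _ _ _ h1' k2 _).trans e3.symm)
  have d1 := congrArg Γ.d hm.2.2.1
  have d2 := congrArg Γ.d hm'.2.2.1
  have d3 := congrArg Γ.d hn.2.2.1
  rw [Γ.d_comp _ _ hm.1, Γ.d_comp _ _ hm.2.1] at d1
  rw [Γ.d_comp _ _ hm'.1, Γ.d_comp _ _ hm'.2.1] at d2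
  rw [Γ.d_comp _ _ h2, Γ.d_comp _ _ h2'] at d3
  rw [Γ.d_comp _ _ h1, Γ.d_comp _ _ h1'] at hd
  funext i
  have f1 := congrFun d1 i
  have f2 := congrFun d2 i
  have f3 := congrFun d3 i
  have f4 := congrFun hd i
  simp only [Pi.add_apply] at f1 f2 f3 f4
  omega

/-! ### Existence of boundary paths -/

/-- An increasing sequence of paths has a limit in the path space. -/
theorem exists_limit (f : ℕ → Λ) (hf : ∀ i j, i ≤ j → Γ.Extends (f i) (f j)) :
    ∃ x : PathSpace Γ, ∀ i, x.Begins (f i) := by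
  set m : Fin k → ℕ∞ := fun c => ⨆ i, (Γ.d (f i) c : ℕ∞)
  have hle : ∀ i, toInf (Γ.d (f i)) ≤ m := fun i c => le_iSup (fun i => (Γ.d (f i) c : ℕ∞)) i
  have hex : ∀ n, toInf n ≤ m → ∃ i, n ≤ Γ.d (f i) := by
    intro n hn
    have h1 : ∀ c, ∃ i, n c ≤ Γ.d (f i) c := by
      intro c
      by_contra! hc
      -- Then `0 < n c`, and `n c - 1` is an upper bound of the degrees in coordinate `c`.
      have h0 : 0 < n c := (Nat.zero_le _).trans_lt (hc 0)
      have h2 : m c ≤ ((n c - 1 : ℕ) : ℕ∞) :=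
        iSup_le fun i => Nat.cast_le.mpr (Nat.le_sub_one_of_lt (hc i))
      have h3 : ((n c : ℕ) : ℕ∞) ≤ ((n c - 1 : ℕ) : ℕ∞) := (hn c).trans h2
      have h4 := Nat.cast_le.mp h3
      omega
    choose i hi using h1
    exact ⟨Finset.univ.sup i, fun c =>
      (hi c).trans ((hf _ _ (Finset.le_sup (Finset.mem_univ c))).d_le c)⟩
  have hseg : ∀ n, toInf n ≤ m → ∃ b, Γ.d b = n ∧ ∃ i, Γ.Extends b (f i) := by
    intro n hn
    obtain ⟨i, hi⟩ := hex n hn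
    obtain ⟨b, c, h1, h2, h3⟩ := Γ.exists_factor (f i) hi
    exact ⟨b, h3, i, c, h1, h2⟩
  choose g hgd hgi using hseg
  have hmono : ∀ p q (hpq : p ≤ q) (h : toInf q ≤ m),
      Γ.Extends (g p ((toInf_mono hpq).trans h)) (g q h) := by
    intro p q hpq h
    obtain ⟨i, hi⟩ := hgi p ((toInf_mono hpq).trans h)
    obtain ⟨j, hj⟩ := hgi q h
    exact (hi.trans (hf _ _ (le_max_left i j))).of_d_le (hj.trans (hf _ _ (le_max_right i j)))
      (by rw [hgd, hgd]; exact hpq)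
  refine ⟨ofInit m g hgd hmono, fun i => ⟨hle i, (ofInit_seg m g hgd hmono _ (hle i)).trans ?_⟩⟩
  obtain ⟨j, hj⟩ := hgi _ (hle i)
  exact (hj.trans (hf _ _ (le_max_left j i))).eq_of_d (hf _ _ (le_max_right j i)) (hgd _ _)

/-- Every path starting at `v` can be extended so as to meet one requirement of the boundary
condition; as there are countably many requirements, a suitable increasing sequence of paths meets
all of them, and its limit is a boundary path. -/
theorem exists_isBoundary (Γ : KGraph k Λ) {v : Λ} (hv : Γ.d v = 0) :
    ∃ x : PathSpace Γ, x.IsBoundary ∧ x.range = v := by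
  classical
  let := Γ.extPreorder
  have := Γ.countable
  let := Encodable.ofCountable ((Fin k → ℕ) × Finset Λ)
  -- The paths `c` that cannot be extended to a path at which the requirement `(n, E)` applies, or
  -- that have met it.
  let D : (Fin k → ℕ) × Finset Λ → Order.Cofinal Λ := fun t =>
    { carrier := {c | (∃ a, Γ.d a = t.1 ∧ Γ.Extends a c ∧
          ∃ e ∈ t.2, Γ.s a = Γ.r e ∧ Γ.Extends (Γ.comp a e) c) ∨
        ∀ a b, Γ.d a = t.1 → Γ.Extends c b → Γ.Extends a b →
          ¬ Γ.IsFiniteExhaustive (Γ.s a) (t.2 : Set Λ)}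
      isCofinal := by
        intro c
        by_cases H : ∀ a b, Γ.d a = t.1 → Γ.Extends c b → Γ.Extends a b →
          ¬ Γ.IsFiniteExhaustive (Γ.s a) (t.2 : Set Λ)
        · exact ⟨c, Or.inr H, le_rfl⟩
        · push Not at H
          obtain ⟨a, b, had, hcb, ⟨g, hg, rfl⟩, hE⟩ := H
          obtain ⟨e, he, ⟨α, β⟩, h1, h2, h3, -⟩ := hE.2.2 g hg.symm
          have hae : Γ.s a = Γ.r e := (hE.2.1 e he).symm
          have hext : Γ.Extends (Γ.comp a g) (Γ.comp (Γ.comp a g) β) :=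
            ⟨β, by rw [Γ.s_comp _ _ hg]; exact h2, rfl⟩
          refine ⟨Γ.comp (Γ.comp a g) β,
            Or.inl ⟨a, had, Extends.trans ⟨g, hg, rfl⟩ hext, e, he, hae, α, ?_, ?_⟩,
            Extends.trans hcb hext⟩
          · rw [Γ.s_comp _ _ hae]; exact h1
          · rw [Γ.assoc _ _ _ hae h1, Γ.assoc _ _ _ hg h2]
            exact congrArg _ h3 }
  obtain ⟨x, hx⟩ := exists_limit (Order.sequenceOfCofinals v D) fun i j hij =>
    Order.sequenceOfCofinals.monotone v D hij
  refine ⟨x, isBoundary_iff.mpr ?_, ?_⟩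
  · rintro a z hz hazx E hE
    have hxa : x.Begins a := begins_iff.mpr ⟨z, hz, hazx⟩
    have hi := Order.sequenceOfCofinals.encode_mem v D (Γ.d a, hE.1.toFinset)
    have hxi := hx (Encodable.encode (Γ.d a, hE.1.toFinset) + 1)
    rcases hi with ⟨a', ha', ha'i, e, he, hae, hei⟩ | H
    · obtain rfl := (hxi.of_extends ha'i).eq_of_d hxa ha'
      have h := hxi.of_extends hei
      rw [← hazx, begins_prepend_comp_iff hae] at h
      exact ⟨e, hE.1.mem_toFinset.mp he, h⟩
    · obtain ⟨b, -, h1, h2⟩ := hxi.exists_extends hxa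
      exact absurd (by simpa using hE) (H a b rfl h1 h2)
  · have h0 : x.Begins v := hx 0
    rw [h0.range_eq, Γ.eq_s_of_d hv, Γ.r_s]

end PathSpace

/-! ### Condition (A) and approximation by aperiodic boundary paths -/

theorem conditionA_iff : Γ.ConditionA ↔ ∀ v, Γ.d v = 0 →
    ∃ x : PathSpace Γ, x.IsBoundary ∧ x.range = v ∧ x.IsAperiodic := by
  simp only [PathSpace.isAperiodic_iff]
  rfl

open PathSpace

/-- The approximation step: if a boundary path begins with `μ` but with none of the finitely many
`ν ∈ N`, then `Ext(μ; N)` is not exhaustive, which leaves room for an aperiodic boundary path with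
the same property. -/
theorem ConditionA.exists_isAperiodic [Γ.FinitelyAligned] (hA : Γ.ConditionA) {x : PathSpace Γ}
    (hx : x.IsBoundary) {μ : Λ} {N : Set Λ} (hN : N.Finite) (hμ : x.Begins μ)
    (hν : ∀ ν ∈ N, ¬ x.Begins ν) :
    ∃ y : PathSpace Γ, y.IsBoundary ∧ y.IsAperiodic ∧ y.Begins μ ∧ ∀ ν ∈ N, ¬ y.Begins ν := by
  rw [conditionA_iff] at hA
  obtain ⟨z, hz, hzx⟩ := begins_iff.mp hμ
  have hne : ¬ Γ.IsFiniteExhaustive (Γ.s μ) (Γ.extSet μ N) := by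
    intro hE
    obtain ⟨α, ⟨ν, hνN, β, hm⟩, hα⟩ := isBoundary_iff.mp hx μ z hz hzx _ hE
    refine hν ν hνN ?_
    rw [← hzx]
    exact ((begins_prepend_comp_iff hm.1 hz).mpr hα).of_extends ⟨β, hm.2.1, hm.2.2.1.symm⟩
  obtain ⟨c, hc, hcE⟩ : ∃ c, Γ.r c = Γ.s μ ∧ ∀ α ∈ Γ.extSet μ N, ¬ (Γ.minExt α c).Nonempty := by
    by_contra! H
    exact hne ⟨finite_extSet μ hN, fun α ⟨_, _, _, hm⟩ => hm.1.symm, H⟩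
  -- If `μ c y` began with some `ν ∈ N`, then `c y` would begin with some `α ∈ Ext(μ; N)`, and
  -- `Λ^min(α, c)` would not be empty.
  obtain ⟨y, hy, hyr, hya⟩ := hA (Γ.s c) (Γ.d_s c)
  have h2 : Γ.s μ = (prepend c y hyr.symm).range := by rw [range_prepend, hc]
  refine ⟨prepend μ (prepend c y hyr.symm) h2, (hy.prepend _).prepend _, (hya.prepend _).prepend _,
    begins_prepend _ _ _, fun ν hνN hb => ?_⟩
  obtain ⟨w, hw, e⟩ := begins_iff.mp hb
  obtain ⟨⟨α, β⟩, hm, u, k1, k2, k3, -⟩ := exists_min_path h2 hw e.symm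
  obtain ⟨p, hp, -⟩ := exists_min_path hyr.symm k1 k3
  exact hcE α ⟨ν, hνN, β, hm⟩ (minExt_nonempty_symm ⟨p, hp⟩)

variable [Γ.FinitelyAligned]

/-! ### Germs, isotropy and the topology on the units -/

/-- Whether a germ is a unit can be read off from the pair of `F` that acts at `x`: if `(a, b)` and
some `(p, p)` agree near `x`, then `a g = b g` for some `g`, and unique factorization yields
`a = b`. -/
theorem Germ.mk_eq_unit_iff {F : InvSemi Γ} {x : PathSpace Γ} {hx : x ∈ F.D} :
    Germ.mk F x hx = Germ.unit x ↔ ∃ μ, (μ, μ) ∈ F.carrier ∧ x.Begins μ := by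
  constructor
  · intro h
    obtain ⟨-, P, hP, ⟨⟨p, p'⟩, hpP, hxp⟩, e⟩ := Quotient.exact h
    dsimp only at e hxp
    rw [InvSemi.mul_eq_iff hP] at e
    obtain ⟨⟨a, b⟩, hqF, hxq⟩ := hx
    obtain ⟨c, hxc, ⟨g, hg, rfl⟩, ⟨g', hg', e'⟩⟩ := hxq.exists_extends hxp
    have hab := F.s_eq _ hqF
    dsimp only at hg hab
    have hact : P.Act (Γ.comp p g') (Γ.comp b g) := ⟨_, hpP, g', hg', rfl, e'.symm⟩
    have hself := hact
    rw [InvSemi.isIdempotentElem_iff.mp hP _ _ hact] at hself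
    obtain ⟨_, rfl, f, -, h1, h2⟩ :=
      (e (Γ.comp a g) _ hself).mp ⟨_, hqF, g, hg, rfl, rfl⟩
    have heq : Γ.comp a g = Γ.comp b g := h1.trans h2.symm
    have hd := congrArg Γ.d heq
    rw [Γ.d_comp _ _ (hab.trans hg), Γ.d_comp _ _ hg] at hd
    obtain rfl : a = b := (Γ.factor_inj (hab.trans hg) hg heq (add_right_cancel hd)).1
    exact ⟨a, hqF, hxq⟩
  · rintro ⟨μ, hμF, hxμ⟩
    have hP : IsIdempotentElem (InvSemi.single (Γ := Γ) μ μ rfl) := by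
      rw [InvSemi.isIdempotentElem_iff]
      rintro _ _ ⟨_, rfl, g, -, rfl, rfl⟩
      rfl
    refine Germ.mk_eq hP ⟨_, rfl, hxμ⟩ ((InvSemi.mul_eq_iff hP).mpr ?_)
    rintro z _ ⟨_, rfl, g, hg, -, rfl⟩
    have hF : F.Act (Γ.comp μ g) (Γ.comp μ g) := ⟨_, hμF, g, hg, rfl, rfl⟩
    have hr : x.range = Γ.r (Γ.comp μ g) := by rw [hxμ.range_eq, Γ.r_comp _ _ hg]
    have hI : (InvSemi.idAt x).Act (Γ.comp μ g) (Γ.comp μ g) :=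
      ⟨_, rfl, Γ.comp μ g, by dsimp only; rw [hr, Γ.s_r], by dsimp only; rw [hr, Γ.id_comp],
        by dsimp only; rw [hr, Γ.id_comp]⟩
    constructor
    · intro h
      rw [InvSemi.act_fun h hF]
      exact hI
    · intro h
      rw [InvSemi.act_fun h hI]
      exact hF

theorem unit_mem_Psi_iff {F : InvSemi Γ} {x : PathSpace Γ} :
    Germ.unit x ∈ Psi F ↔ ∃ μ, (μ, μ) ∈ F.carrier ∧ x.Begins μ := by
  constructor
  · rintro ⟨y, hy, e⟩
    obtain rfl : x = y := congrArg Germ.src e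
    exact Germ.mk_eq_unit_iff.mp e.symm
  · rintro ⟨μ, hμF, hxμ⟩
    exact ⟨x, ⟨_, hμF, hxμ⟩, (Germ.mk_eq_unit_iff.mpr ⟨μ, hμF, hxμ⟩).symm⟩

/-- A germ with source and range `x` is given by a pair `(a, b)` with `a z = x = b z`; so the isotropy
at `x` is trivial if and only if `x` is aperiodic. -/
theorem isAperiodic_iff_germ {x : PathSpace Γ} :
    x.IsAperiodic ↔ ∀ g : Germ Γ, g.src = x → g.tgt = x → g = Germ.unit x := by
  constructor
  · intro H g hs ht
    obtain ⟨F, y, hy, rfl⟩ := g.exists_mk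
    obtain rfl : y = x := hs
    obtain ⟨⟨a, b⟩, hp, z, h1, h2, e1, e2⟩ := InvSemi.pact_theta F y hy
    have e3 : prepend a z h1 = y := e1.symm.trans ht
    have hxa : y.Begins a := begins_iff.mpr ⟨z, h1, e3⟩
    have hxb : y.Begins b := begins_iff.mpr ⟨z, h2, e2.symm⟩
    obtain rfl := hxa.eq_of_d hxb (H a b z h1 h2 e3 e2.symm)
    exact Germ.mk_eq_unit_iff.mpr ⟨a, hp, hxa⟩
  · intro H a b z ha hb h1 h2
    have hmem : x ∈ (InvSemi.single a b (ha.trans hb.symm)).D :=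
      ⟨_, rfl, begins_iff.mpr ⟨z, hb, h2⟩⟩
    have ht : (Germ.mk _ x hmem).tgt = x :=
      InvSemi.pact_fun (InvSemi.pact_theta _ _ hmem) ⟨_, rfl, z, ha, hb, h1.symm, h2.symm⟩
    obtain ⟨μ, hμ, -⟩ := Germ.mk_eq_unit_iff.mp (H _ rfl ht)
    have e1 : μ = a := congrArg Prod.fst hμ
    have e2 : μ = b := congrArg Prod.snd hμ
    rw [← e1, ← e2]

/-- On units, a basic open set contains a neighbourhood given by one path that is required and
finitely many paths that are excluded as initial segments. -/
theorem exists_cylinder {f : Set (Set (Germ Γ))} (hf : f.Finite)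
    (hsub : f ⊆ {A | ∃ F : InvSemi Γ, A = Psi F ∨ A = (Psi F)ᶜ}) (x : PathSpace Γ)
    (hx : Germ.unit x ∈ ⋂₀ f) :
    ∃ (μ : Λ) (N : Set Λ), N.Finite ∧ x.Begins μ ∧ (∀ ν ∈ N, ¬ x.Begins ν) ∧
      ∀ y : PathSpace Γ, y.Begins μ → (∀ ν ∈ N, ¬ y.Begins ν) → Germ.unit y ∈ ⋂₀ f := by
  induction f, hf using Set.Finite.induction_on with
  | empty => exact ⟨x.range, ∅, Set.finite_empty, x.begins_range, by simp, by simp⟩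
  | @insert A f _ _ ih =>
    rw [Set.sInter_insert] at hx
    obtain ⟨μ, N, hN, hμ, hν, H⟩ := ih ((Set.subset_insert _ _).trans hsub) hx.2
    obtain ⟨F, rfl | rfl⟩ := hsub (Set.mem_insert _ _)
    · obtain ⟨μ', hF, hμ'⟩ := unit_mem_Psi_iff.mp hx.1
      obtain ⟨c, hc, h1, h2⟩ := hμ.exists_extends hμ'
      refine ⟨c, N, hN, hc, hν, fun y hy hyν => ?_⟩
      rw [Set.sInter_insert]
      exact ⟨unit_mem_Psi_iff.mpr ⟨μ', hF, hy.of_extends h2⟩, H y (hy.of_extends h1) hyν⟩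
    · refine ⟨μ, N ∪ {ν | (ν, ν) ∈ F.carrier}, hN.union ?_, hμ, ?_, fun y hy hyν => ?_⟩
      · exact F.finite.preimage (f := fun ν => (ν, ν)) fun a _ b _ h => congrArg Prod.fst h
      · rintro ν (h | h)
        · exact hν ν h
        · exact fun hb => hx.1 (unit_mem_Psi_iff.mpr ⟨ν, h, hb⟩)
      · rw [Set.sInter_insert]
        refine ⟨fun h => ?_, H y hy fun ν hν => hyν ν (Or.inl hν)⟩
        obtain ⟨ν, h1, h2⟩ := unit_mem_Psi_iff.mp h
        exact hyν ν (Or.inr h1) h2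

/-! ### Essential freeness of the boundary groupoid -/

/-- The unit of the boundary groupoid at a boundary path. -/
noncomputable def boundaryUnit (x : PathSpace Γ) (hx : x.IsBoundary) : Γ.boundaryGroupoid.units :=
  ⟨⟨Germ.unit x, by
    change Germ.unit (Germ.unit x).tgt ∈ _ ∧ Germ.unit (Germ.unit x).src ∈ _
    rw [Germ.tgt_unit, Germ.src_unit]
    exact ⟨⟨x, hx, rfl⟩, ⟨x, hx, rfl⟩⟩⟩, Subtype.ext (congrArg Germ.unit (Germ.tgt_unit x))⟩

theorem exists_eq_boundaryUnit (u : Γ.boundaryGroupoid.units) :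
    ∃ x hx, u = boundaryUnit x hx := by
  obtain ⟨⟨g, ⟨x, hx, e⟩, -⟩, hu⟩ := u
  have h : Germ.unit g.tgt = g := congrArg Subtype.val hu
  have e' : Germ.unit g.tgt = Germ.unit x := e
  exact ⟨x, hx, Subtype.ext (Subtype.ext (h.symm.trans e'))⟩

theorem hasTrivialIsotropy_boundaryUnit_iff {x : PathSpace Γ} {hx : x.IsBoundary} :
    Γ.boundaryGroupoid.HasTrivialIsotropy (boundaryUnit x hx) ↔ x.IsAperiodic := by
  rw [isAperiodic_iff_germ]
  constructor
  · intro H g hs ht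
    have h := H ⟨g, ⟨x, hx, congrArg Germ.unit ht⟩, ⟨x, hx, congrArg Germ.unit hs⟩⟩
      (Subtype.ext (congrArg Germ.unit ht)) (Subtype.ext (congrArg Germ.unit hs))
    exact congrArg Subtype.val h
  · intro H g hr hs
    exact Subtype.ext (H g.1 (Germ.unit_inj (congrArg Subtype.val hs))
      (Germ.unit_inj (congrArg Subtype.val hr)))

/-- Essential freeness in terms of paths: the aperiodic boundary paths are dense in `∂Λ`, for the
topology on `∂Λ` induced by `x ↦ unit x`. -/
theorem isEssentiallyFree_iff : Γ.boundaryGroupoid.IsEssentiallyFree ↔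
    ∀ x : PathSpace Γ, x.IsBoundary → ∀ V : Set (Germ Γ), IsOpen V → Germ.unit x ∈ V →
      ∃ y : PathSpace Γ, y.IsBoundary ∧ y.IsAperiodic ∧ Germ.unit y ∈ V := by
  unfold ArrowGroupoid.IsEssentiallyFree
  rw [dense_iff_inter_open]
  constructor
  · intro H x hx V hV hxV
    obtain ⟨u, hu, ht⟩ := H (Subtype.val ⁻¹' (Subtype.val ⁻¹' V))
      ((hV.preimage continuous_subtype_val).preimage continuous_subtype_val)
      ⟨boundaryUnit x hx, hxV⟩
    obtain ⟨y, hy, rfl⟩ := exists_eq_boundaryUnit u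
    exact ⟨y, hy, hasTrivialIsotropy_boundaryUnit_iff.mp ht, hu⟩
  · rintro H U hU ⟨u, hu⟩
    obtain ⟨W, hW, rfl⟩ := isOpen_induced_iff.mp hU
    obtain ⟨V, hV, rfl⟩ := isOpen_induced_iff.mp hW
    obtain ⟨x, hx, rfl⟩ := exists_eq_boundaryUnit u
    obtain ⟨y, hy, hya, hyV⟩ := H x hx V hV hu
    exact ⟨boundaryUnit y hy, hyV, hasTrivialIsotropy_boundaryUnit_iff.mpr hya⟩

end KGraph

open KGraph in
theorem mainTheorem4 {k : ℕ} {Λ : Type*} (Γ : KGraph k Λ) [Γ.FinitelyAligned] :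
    Γ.ConditionA ↔ Γ.boundaryGroupoid.IsEssentiallyFree := by
  rw [isEssentiallyFree_iff]
  constructor
  · intro hA x hx V hV hxV
    obtain ⟨_, ⟨f, ⟨hf, hsub⟩, rfl⟩, hxf, hfV⟩ :=
      (TopologicalSpace.isTopologicalBasis_of_subbasis rfl).exists_subset_of_mem_open hxV hV
    obtain ⟨μ, N, hN, hμ, hν, H⟩ := exists_cylinder hf hsub x hxf
    obtain ⟨y, hy, hya, hyμ, hyν⟩ := hA.exists_isAperiodic hx hN hμ hν
    exact ⟨y, hy, hya, hfV (H y hyμ hyν)⟩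
  · intro H
    rw [conditionA_iff]
    intro v hv
    -- A boundary path from `v` shows that the open set of units with range `v` is not empty.
    obtain ⟨x, hx, rfl⟩ := PathSpace.exists_isBoundary Γ hv
    obtain ⟨y, hy, hya, hyV⟩ := H x hx (Psi (InvSemi.idAt x))
      (TopologicalSpace.isOpen_generateFrom_of_mem ⟨_, Or.inl rfl⟩) ⟨x, _, rfl⟩
    obtain ⟨μ, hμ, hyμ⟩ := unit_mem_Psi_iff.mp hyV
    obtain rfl : μ = x.range := congrArg Prod.fst hμ
    exact ⟨y, hy, by rw [hyμ.range_eq, Γ.eq_s_of_d hv, Γ.r_s], hya⟩
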